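/- For $n\ge 1$ let $\varphi$ be a mapping of $\{1,\dots,n\}$ to itself chosen uniformly at random among all $n^n$ such mappings. Let $\Lambda_n$ be the length of the longest cycle of (the functional graph of) $\varphi$, and let $N_n$ be the number of cyclic points of $\varphi$, i.e. of points $x$ with $\varphi^{k}(x)=x$ for some $k\ge 1$. Let $\rho$ be Dickman's function: the continuous function on $[0,\infty)$ with $\rho(x)=1$ for $0\le x\le 1$ and $x\,\rho'(x)+\rho(x-1)=0$ for $x>1$. Define $$f(\lambda,\nu)=\frac{\nu}{\lambda}\,\exp\!\left(-\frac{\nu^{2}}{2}\right)\rho\!\left(\frac{\nu-\lambda}{\lambda}\right)\quad\text{for } 0<\lambda<\nu<\infty,$$ and $f(\lambda,\nu)=0$ for all other $(\lambda,\nu)\in\mathbb{R}^2$. Then $f$ is a probability density on $\mathbb{R}^2$ (it is nonnegative and has integral $1$), and as $n\to\infty$ the pair $\left(\Lambda_n/\sqrt{n},\,N_n/\sqrt{n}\right)$ converges in distribution to the probability law on $\mathbb{R}^2$ with density $f$ with respect to Lebesgue measure. -/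

import Mathlib

open MeasureTheory ProbabilityTheory Filter

noncomputable section

/-- Successive approximations to Dickman's function: the `k`-th one is correct on `(-∞, k + 1]`. -/
def dickmanAux : ℕ → ℝ → ℝ
  | 0, x => if 0 ≤ x then 1 else 0
  | k + 1, x =>
      if x ≤ 1 then (if 0 ≤ x then 1 else 0)
      else 1 - ∫ t in (1 : ℝ)..x, dickmanAux k (t - 1) / t

/-- Dickman's function `ρ`. It is the function, continuous on `[0, ∞)`, such that `ρ x = 0` for
`x < 0`, `ρ x = 1` for `0 ≤ x ≤ 1` and `x * ρ' x + ρ (x - 1) = 0` for `x > 1`; that it has these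
properties is proved below in `dickman_of_neg`, `dickman_of_mem_Icc`, `continuousOn_dickman`,
`hasDerivAt_dickman` and `dickman_delay`. -/
def dickman (x : ℝ) : ℝ := dickmanAux ⌊x⌋₊ x

theorem dickman_of_neg {x : ℝ} (hx : x < 0) : dickman x = 0 := by
  have : ⌊x⌋₊ = 0 := Nat.floor_of_nonpos hx.le
  simp [dickman, this, dickmanAux, not_le.mpr hx]

theorem dickmanAux_of_le_one (k : ℕ) {x : ℝ} (hx : x ≤ 1) :
    dickmanAux k x = if 0 ≤ x then 1 else 0 := by
  cases k <;> simp [dickmanAux, hx]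

theorem dickman_of_mem_Icc {x : ℝ} (h0 : 0 ≤ x) (h1 : x ≤ 1) : dickman x = 1 := by
  simp [dickman, dickmanAux_of_le_one _ h1, h0]

theorem dickmanAux_succ (k : ℕ) {x : ℝ} (hx : x ≤ k + 1) :
    dickmanAux (k + 1) x = dickmanAux k x := by
  induction k generalizing x with
  | zero => rw [dickmanAux_of_le_one _ (by simpa using hx), dickmanAux_of_le_one _ (by simpa using hx)]
  | succ k ih =>
    by_cases h1 : x ≤ 1
    · rw [dickmanAux_of_le_one _ h1, dickmanAux_of_le_one _ h1]
    · rw [dickmanAux, dickmanAux, if_neg h1, if_neg h1]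
      congr 1
      apply intervalIntegral.integral_congr
      intro t ht
      rw [Set.uIcc_of_le (not_le.mp h1).le] at ht
      push_cast at hx
      simp only
      rw [ih (by linarith [ht.2])]

theorem dickman_eq_aux (m : ℕ) {x : ℝ} (hx : x ≤ m + 1) : dickman x = dickmanAux m x := by
  have key : ∀ k j : ℕ, x ≤ k + 1 → dickmanAux (k + j) x = dickmanAux k x := by
    intro k j hk
    induction j with
    | zero => rfl
    | succ j ih => rw [← add_assoc, dickmanAux_succ _ (by push_cast; linarith), ih]
  rcases le_total ⌊x⌋₊ m with h | h
  · obtain ⟨j, rfl⟩ := Nat.exists_eq_add_of_le h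
    exact (key _ _ (Nat.lt_floor_add_one x).le).symm
  · obtain ⟨j, hj⟩ := Nat.exists_eq_add_of_le h
    rw [dickman, hj, key _ _ hx]

theorem dickman_eq_integral {x : ℝ} (hx : 1 ≤ x) :
    dickman x = 1 - ∫ t in (1 : ℝ)..x, dickman (t - 1) / t := by
  rcases hx.eq_or_lt with rfl | h1
  · simp [dickman_of_mem_Icc]
  have hc : x ≤ (⌈x⌉₊ : ℝ) := Nat.le_ceil x
  rw [dickman_eq_aux (⌈x⌉₊ + 1) (by push_cast; linarith), dickmanAux, if_neg (not_le.mpr h1)]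
  congr 1
  apply intervalIntegral.integral_congr
  intro t ht
  rw [Set.uIcc_of_le h1.le] at ht
  simp only
  rw [dickman_eq_aux ⌈x⌉₊ (by linarith [ht.2])]

theorem continuousOn_dickmanAux (k : ℕ) : ContinuousOn (dickmanAux k) (Set.Ici 0) := by
  induction k with
  | zero =>
    refine (continuousOn_const (c := (1 : ℝ))).congr fun x hx => ?_
    simp [dickmanAux, Set.mem_Ici.mp hx]
  | succ k ih =>
    have hint : ∀ b : ℝ, ContinuousOn (fun t : ℝ => dickmanAux k (t - 1) / t) (Set.Icc 1 b) := by
      intro b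
      refine (ih.comp (continuousOn_id.sub continuousOn_const) ?_).div continuousOn_id ?_
      · intro t ht
        simpa using ht.1
      · intro t ht
        exact (lt_of_lt_of_le one_pos ht.1).ne'
    have hprim : ContinuousOn (fun x => 1 - ∫ t in (1 : ℝ)..x, dickmanAux k (t - 1) / t)
        (Set.Ici 1) := by
      generalize (fun t : ℝ => dickmanAux k (t - 1) / t) = g at hint ⊢
      intro x hx
      have hx : (1 : ℝ) ≤ x := hx
      have hg : IntegrableOn g (Set.uIcc 1 (x + 1)) volume := by
        rw [Set.uIcc_of_le (by linarith)]
        exact (hint _).integrableOn_Icc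
      have h1 := intervalIntegral.continuousOn_primitive_interval hg
      rw [Set.uIcc_of_le (by linarith)] at h1
      have hmem : Set.Icc 1 (x + 1) ∈ nhdsWithin x (Set.Ici 1) := by
        rw [← Set.Ici_inter_Iic]
        exact Filter.inter_mem self_mem_nhdsWithin
          (mem_nhdsWithin_of_mem_nhds (Iic_mem_nhds (by linarith)))
      have h2 : ContinuousWithinAt (fun y => ∫ t in (1 : ℝ)..y, g t) (Set.Ici 1) x :=
        (h1 x ⟨hx, by linarith⟩).mono_of_mem_nhdsWithin hmem
      exact continuousWithinAt_const.sub h2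
    have hleft : ContinuousOn (dickmanAux (k + 1)) (Set.Icc 0 1) :=
      (continuousOn_const (c := (1 : ℝ))).congr fun x hx => by
        rw [dickmanAux_of_le_one _ hx.2, if_pos hx.1]
    have hright : ContinuousOn (dickmanAux (k + 1)) (Set.Ici 1) :=
      hprim.congr fun x hx => by
        rcases (Set.mem_Ici.mp hx).eq_or_lt with rfl | h
        · simp [dickmanAux]
        · rw [dickmanAux, if_neg (not_le.mpr h)]
    have := hleft.union_of_isClosed hright isClosed_Icc isClosed_Ici
    rwa [Set.Icc_union_Ici_eq_Ici zero_le_one] at this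

theorem continuousOn_dickman : ContinuousOn dickman (Set.Ici 0) := by
  intro x hx
  have hc : x ≤ (⌈x⌉₊ : ℝ) := Nat.le_ceil x
  refine (continuousOn_dickmanAux ⌈x⌉₊ x hx).congr_of_eventuallyEq ?_
    (dickman_eq_aux _ (by linarith))
  filter_upwards [mem_nhdsWithin_of_mem_nhds (Iic_mem_nhds (show x < x + 1 by linarith))] with y hy
  exact dickman_eq_aux _ (by linarith [Set.mem_Iic.mp hy])

theorem hasDerivAt_dickman {x : ℝ} (hx : 1 < x) :
    HasDerivAt dickman (-(dickman (x - 1) / x)) x := by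
  have hcont : ContinuousOn (fun t : ℝ => dickman (t - 1) / t) (Set.Ici 1) := by
    refine (continuousOn_dickman.comp (continuousOn_id.sub continuousOn_const) ?_).div
      continuousOn_id ?_
    · intro t ht
      simpa using ht
    · intro t ht
      exact (lt_of_lt_of_le one_pos (Set.mem_Ici.mp ht)).ne'
  have hI : HasDerivAt (fun u => ∫ t in (1 : ℝ)..u, dickman (t - 1) / t) (dickman (x - 1) / x) x := by
    refine intervalIntegral.integral_hasDerivAt_right ?_ ?_ ?_
    · apply ContinuousOn.intervalIntegrable
      rw [Set.uIcc_of_le hx.le]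
      exact hcont.mono Set.Icc_subset_Ici_self
    · exact (hcont.mono Set.Ioi_subset_Ici_self).stronglyMeasurableAtFilter isOpen_Ioi x hx
    · exact hcont.continuousAt (Ici_mem_nhds hx)
  refine (hI.const_sub 1).congr_of_eventuallyEq ?_
  filter_upwards [Ioi_mem_nhds hx] with y hy
  exact dickman_eq_integral (le_of_lt hy)

theorem dickman_delay {x : ℝ} (hx : 1 < x) : x * deriv dickman x + dickman (x - 1) = 0 := by
  rw [(hasDerivAt_dickman hx).deriv]
  field_simp
  ring

/-- The number of cyclic points of a mapping of `{1, …, n}` to itself. -/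
def numCyclicPoints {n : ℕ} (φ : Fin n → Fin n) : ℕ := (Function.periodicPts φ).ncard

/-- The length of the longest cycle of a mapping of `{1, …, n}` to itself: the length of the cycle
through a cyclic point is its minimal period, and `Function.minimalPeriod` is `0` at the points that
are not cyclic. -/
def longestCycle {n : ℕ} (φ : Fin n → Fin n) : ℕ :=
  Finset.univ.sup fun x => Function.minimalPeriod φ x

/-- The uniform probability measure on the mappings of `{1, …, n}` to itself. -/
def uniformMapping (n : ℕ) : Measure (Fin n → Fin n) := uniformOn Set.univ

instance uniformMapping_isProbabilityMeasure (n : ℕ) : IsProbabilityMeasure (uniformMapping n) :=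
  isProbabilityMeasure_uniformOn Set.finite_univ ⟨id, Set.mem_univ _⟩

/-- The pair `(Λ, N)` of the longest cycle length and the number of cyclic points, both divided
by `√n`. -/
def scaledPair (n : ℕ) (φ : Fin n → Fin n) : ℝ × ℝ :=
  ((longestCycle φ : ℝ) / √(n : ℝ), (numCyclicPoints φ : ℝ) / √(n : ℝ))

/-- The function `f(l, v) = (v / l) * exp (-v² / 2) * ρ ((v - l) / l)` for `0 < l < v`, extended
by `0`. -/
def jointDensity (l v : ℝ) : ℝ :=
  if 0 < l ∧ l < v then v / l * Real.exp (-v ^ 2 / 2) * dickman ((v - l) / l) else 0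

/-- The measure on the plane whose density with respect to Lebesgue measure is `jointDensity`. -/
def limitLaw : Measure (ℝ × ℝ) :=
  volume.withDensity fun p => ENNReal.ofReal (jointDensity p.1 p.2)

end

/-! A mapping with cyclic set `C` is a permutation of `C` together with a forest rooted at `C`, and
the two can be chosen independently (`mappingEquiv`). Hence, given that there are `m` cyclic points,
the longest cycle is distributed as in a uniform permutation of `m` letters
(`factorial_mul_card_ncard_eq_cyclesLe`), and the proof splits into two asymptotic questions.

The number of cyclic points: the `m`-th factorial moment of the number of fixed points of a uniform
permutation of `c` letters is `1` if `m ≤ c` and `0` otherwise. So the probability of at least `m`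
cyclic points is the `m`-th factorial moment of the number of fixed points of a random mapping,
which is computed directly (`card_le_ncard_periodicPts`). It is `∏ i < m, (1 - i / n)`, and this
gives the Rayleigh density `v * exp (-v² / 2)` in the limit.

The longest cycle of a permutation: the probability `p m` of having no cycle longer than `k`
satisfies `m * p m = p (m - k) + ... + p (m - 1)` for `m ≥ k`, a discrete form of `x * ρ x = ∫ t in
(x - 1)..x, ρ t`. Comparing the two gives `p m → ρ x` when `m / k → x` and `k → ∞`
(`tendsto_permCyclesLeProb`).

Dominated convergence then yields the limit of the bivariate distribution function
(`tendsto_uniformMapping_quadrant`). It is the distribution function of `limitLaw`, because `l ↦ ρ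
(v / l)` has derivative `ρ ((v - l) / l) / l` on `(0, v)`. Convergence on quadrants passes to
rectangles and so to weak convergence. -/

/-! ### Dickman's function: averaging identity, positivity, monotonicity, decay -/

theorem intervalIntegrable_dickman {a b : ℝ} (ha : 0 ≤ a) (hb : 0 ≤ b) :
    IntervalIntegrable dickman volume a b :=
  (continuousOn_dickman.mono fun _ hx => le_trans (le_min ha hb) hx.1).intervalIntegrable

/-- By the delay equation, `t * ρ t` has derivative `ρ t - ρ (t - 1)` for `t > 1`. Integrate from
`1` to `x`; the boundary value `1 * ρ 1 = 1` is the integral of `ρ` over `[0, 1]`. -/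
theorem mul_dickman_eq_integral {x : ℝ} (hx : 1 ≤ x) :
    x * dickman x = ∫ t in (x - 1)..x, dickman t := by
  have hcont : ContinuousOn (fun t : ℝ => t * dickman t) (Set.Icc 1 x) :=
    continuousOn_id.mul (continuousOn_dickman.mono fun t ht => by
      simpa using zero_le_one.trans ht.1)
  have hsub : IntervalIntegrable (fun t => dickman (t - 1)) volume 1 x := by
    apply ContinuousOn.intervalIntegrable
    refine continuousOn_dickman.comp (continuousOn_id.sub continuousOn_const) fun t ht => ?_
    rw [Set.uIcc_of_le hx] at ht
    simpa using ht.1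
  have h01 : ∫ t in (0 : ℝ)..1, dickman t = 1 := by
    rw [intervalIntegral.integral_congr (g := fun _ => (1 : ℝ))]
    · simp
    · intro t ht
      rw [Set.uIcc_of_le zero_le_one] at ht
      exact dickman_of_mem_Icc ht.1 ht.2
  have h := intervalIntegral.integral_eq_sub_of_hasDerivAt_of_le hx hcont
    (f' := fun t => dickman t - dickman (t - 1)) (fun t ht => by
      have := (hasDerivAt_id t).mul (hasDerivAt_dickman ht.1)
      refine this.congr_deriv ?_
      have : t ≠ 0 := by linarith [ht.1]
      simp only [id]
      field_simp
      ring)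
    ((intervalIntegrable_dickman zero_le_one (by linarith)).sub hsub)
  rw [intervalIntegral.integral_sub (intervalIntegrable_dickman zero_le_one (by linarith)) hsub,
    intervalIntegral.integral_comp_sub_right (fun t => dickman t), sub_self,
    dickman_of_mem_Icc zero_le_one le_rfl, one_mul] at h
  have h1 := intervalIntegral.integral_add_adjacent_intervals
    (intervalIntegrable_dickman le_rfl zero_le_one)
    (intervalIntegrable_dickman zero_le_one (show (0 : ℝ) ≤ x by linarith))
  have h2 := intervalIntegral.integral_add_adjacent_intervals
    (intervalIntegrable_dickman le_rfl (show (0 : ℝ) ≤ x - 1 by linarith))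
    (intervalIntegrable_dickman (show (0 : ℝ) ≤ x - 1 by linarith) (show (0 : ℝ) ≤ x by linarith))
  linarith

/-- At the least point `z` where positivity fails, the averaging identity would equate `z * ρ z ≤ 0`
with the integral of a function that is positive on `(z - 1, z)`. -/
theorem dickman_pos {x : ℝ} (hx : 0 ≤ x) : 0 < dickman x := by
  by_contra! hneg
  have hcl : IsClosed {y ∈ Set.Ici (0 : ℝ) | dickman y ≤ 0} :=
    continuousOn_dickman.preimage_isClosed_of_isClosed isClosed_Ici isClosed_Iic
  have hbdd : BddBelow {y ∈ Set.Ici (0 : ℝ) | dickman y ≤ 0} := ⟨0, fun y hy => hy.1⟩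
  have hmem := hcl.csInf_mem ⟨x, hx, hneg⟩ hbdd
  set z := sInf {y ∈ Set.Ici (0 : ℝ) | dickman y ≤ 0} with hz
  have hlt : ∀ y, 0 ≤ y → y < z → 0 < dickman y := fun y hy hyz => by
    by_contra! h
    exact absurd (csInf_le hbdd ⟨hy, h⟩) (not_le.mpr hyz)
  have hz1 : 1 < z := by
    by_contra! h
    have := hmem.2
    rw [dickman_of_mem_Icc hmem.1 h] at this
    linarith
  have hint := mul_dickman_eq_integral hz1.le
  have hpos : 0 < ∫ t in (z - 1)..z, dickman t := by
    refine intervalIntegral.intervalIntegral_pos_of_pos_on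
      (intervalIntegrable_dickman (by linarith) (by linarith)) (fun y hy => ?_) (by linarith)
    exact hlt y (by linarith [hy.1]) hy.2
  have := mul_nonpos_of_nonneg_of_nonpos (show (0 : ℝ) ≤ z by linarith) hmem.2
  linarith

theorem dickman_nonneg (x : ℝ) : 0 ≤ dickman x := by
  rcases lt_or_ge x 0 with h | h
  · rw [dickman_of_neg h]
  · exact (dickman_pos h).le

theorem antitoneOn_dickman : AntitoneOn dickman (Set.Ici 0) := by
  have h1 : AntitoneOn dickman (Set.Ici 1) := by
    refine antitoneOn_of_deriv_nonpos (convex_Ici 1)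
      (continuousOn_dickman.mono (Set.Ici_subset_Ici.mpr zero_le_one)) ?_ ?_
    · rw [interior_Ici]
      exact fun x hx => (hasDerivAt_dickman hx).differentiableAt.differentiableWithinAt
    · rw [interior_Ici]
      intro x hx
      rw [(hasDerivAt_dickman hx).deriv]
      have := dickman_nonneg (x - 1)
      have : 0 < x := zero_lt_one.trans hx
      simp only [Left.neg_nonpos_iff]
      positivity
  have h0 : AntitoneOn dickman (Set.Icc 0 1) := fun x hx y hy _ => by
    rw [dickman_of_mem_Icc hx.1 hx.2, dickman_of_mem_Icc hy.1 hy.2]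
  have := h0.union_right h1 (isGreatest_Icc zero_le_one) isLeast_Ici
  rwa [Set.Icc_union_Ici_eq_Ici zero_le_one] at this

theorem dickman_le_one (x : ℝ) : dickman x ≤ 1 := by
  rcases lt_or_ge x 0 with h | h
  · rw [dickman_of_neg h]
    exact zero_le_one
  · rw [← dickman_of_mem_Icc le_rfl zero_le_one]
    exact antitoneOn_dickman (Set.mem_Ici.mpr le_rfl) h h

/-- The integral of `ρ ≤ 1` over a unit interval is at most `1`. This crude decay is what makes
`limitCondCDF v` continuous at `0`. -/
theorem dickman_le_inv {x : ℝ} (hx : 1 ≤ x) : dickman x ≤ x⁻¹ := by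
  have h : ∫ t in (x - 1)..x, dickman t ≤ ∫ _ in (x - 1)..x, (1 : ℝ) :=
    intervalIntegral.integral_mono_on (by linarith)
      (intervalIntegrable_dickman (by linarith) (by linarith)) (by simp)
      fun t _ => dickman_le_one t
  rw [← mul_dickman_eq_integral hx] at h
  simp only [intervalIntegral.integral_const, sub_sub_cancel, smul_eq_mul, mul_one] at h
  rw [le_inv_comm₀ (dickman_pos (by linarith)) (by linarith), ← one_div,
    le_div_iff₀ (dickman_pos (by linarith))]
  exact h

theorem jointDensity_nonneg (l v : ℝ) : 0 ≤ jointDensity l v := by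
  unfold jointDensity
  split_ifs with h
  · have := dickman_nonneg ((v - l) / l)
    have := h.1
    have := h.1.trans h.2
    positivity
  · exact le_rfl

/-! ### Permutations without long cycles: the recursion for their number -/

open Function in
theorem minimalPeriod_eq_of_injective_semiconj {α β : Type*} {f : α → α} {g : β → β} {w : α → β}
    (hw : Injective w) (h : Semiconj w f g) (x : α) :
    minimalPeriod g (w x) = minimalPeriod f x := by
  rw [minimalPeriod_eq_minimalPeriod_iff]
  intro n
  rw [IsPeriodicPt, IsPeriodicPt, IsFixedPt, IsFixedPt, ← (h.iterate_right n).eq]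
  exact hw.eq_iff

theorem minimalPeriod_add_one (j : ℕ) (i : ZMod j) :
    Function.minimalPeriod (fun x : ZMod j => x + 1) i = j := by
  have h : Function.Semiconj (fun x : ZMod j => x + i) (fun x => 1 + x) (fun x => x + 1) :=
    fun x => by ring
  have := minimalPeriod_eq_of_injective_semiconj (add_left_injective i) h 0
  rw [zero_add] at this
  rw [this]
  -- `addOrderOf 1` is by definition the minimal period of `0` under `1 + ·`.
  exact ZMod.addOrderOf_one j

/-- Iterates at `x` depend only on the exponent modulo the minimal period, so the wrap-around of `i
+ 1` in `ZMod j` is harmless. -/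
theorem apply_iterate_zmod_val {α : Type*} {f : α → α} {x : α} {j : ℕ} [NeZero j]
    (h : Function.minimalPeriod f x = j) (i : ZMod j) : f (f^[i.val] x) = f^[(i + 1).val] x := by
  have hmod : i.val + (1 : ZMod j).val ≡ i.val.succ [MOD j] := by
    rw [← ZMod.natCast_eq_natCast_iff]
    simp
  rw [← Function.iterate_succ_apply' f, ZMod.val_add, hmod]
  subst h
  rw [Function.iterate_mod_minimalPeriod_eq]

section Recurrence

variable {α : Type*} [Finite α]

/-- The permutations of `α` with no cycle of length more than `k`. -/
abbrev PermCyclesLe (α : Type*) (k : ℕ) : Type _ :=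
  {σ : Equiv.Perm α // ∀ x, Function.minimalPeriod σ x ≤ k}

theorem card_permCyclesLe_congr {α β : Type*} (e : α ≃ β) (k : ℕ) :
    Nat.card (PermCyclesLe α k) = Nat.card (PermCyclesLe β k) := by
  refine Nat.card_congr (e.permCongr.subtypeEquiv fun σ => ?_)
  have h : Function.Semiconj e σ (e.permCongr σ) := fun x => by simp [Equiv.permCongr_apply]
  refine ⟨fun H y => ?_, fun H x => ?_⟩
  · obtain ⟨x, rfl⟩ := e.surjective y
    rw [minimalPeriod_eq_of_injective_semiconj e.injective h]
    exact H x
  · rw [← minimalPeriod_eq_of_injective_semiconj e.injective h]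
    exact H _

/-- The number of permutations of `m` letters with no cycle of length more than `k`. -/
noncomputable def numPermCyclesLe (m k : ℕ) : ℕ := Nat.card (PermCyclesLe (Fin m) k)

theorem card_permCyclesLe (k : ℕ) :
    Nat.card (PermCyclesLe α k) = numPermCyclesLe (Nat.card α) k :=
  card_permCyclesLe_congr (Finite.equivFin α) k

theorem mem_periodicPts_perm (σ : Equiv.Perm α) (x : α) : x ∈ Function.periodicPts σ :=
  Function.Injective.mem_periodicPts σ.injective x

theorem minimalPeriod_le_card_perm (σ : Equiv.Perm α) (x : α) :
    Function.minimalPeriod σ x ≤ Nat.card α := by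
  have h := Function.iterate_injOn_Iio_minimalPeriod (f := σ) (x := x)
  have := Set.ncard_le_ncard_of_injOn (t := (Set.univ : Set α)) _ (fun _ _ => Set.mem_univ _) h
  simpa [Set.ncard_univ, Set.ncard_Iio_nat] using this

theorem numPermCyclesLe_of_le {m k : ℕ} (h : m ≤ k) : numPermCyclesLe m k = m.factorial := by
  have : ∀ σ : Equiv.Perm (Fin m), ∀ x, Function.minimalPeriod σ x ≤ k := fun σ x =>
    (minimalPeriod_le_card_perm σ x).trans (by simpa using h)
  rw [numPermCyclesLe, Nat.card_congr (Equiv.subtypeUnivEquiv this), Nat.card_perm, Nat.card_fin]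

theorem numPermCyclesLe_le (m k : ℕ) : numPermCyclesLe m k ≤ m.factorial := by
  calc numPermCyclesLe m k ≤ Nat.card (Equiv.Perm (Fin m)) :=
        Nat.card_le_card_of_injective _ Subtype.val_injective
    _ = _ := by rw [Nat.card_perm, Nat.card_fin]

/-- A permutation together with a point on a cycle of length `j` is a permutation together with a
parametrisation of one of its cycles of length `j`. -/
noncomputable def pointedCycleEquiv (α : Type*) [Finite α] (k j : ℕ) [NeZero j] :
    {q : PermCyclesLe α k × α // Function.minimalPeriod q.1.1 q.2 = j} ≃
      Σ w : ZMod j ↪ α, {σ : PermCyclesLe α k // ∀ i, σ.1 (w i) = w (i + 1)} where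
  toFun q := ⟨⟨fun i => q.1.1.1^[i.val] q.1.2, fun a b hab => by
      have := Function.iterate_injOn_Iio_minimalPeriod (f := q.1.1.1) (x := q.1.2)
      refine ZMod.val_injective j (this ?_ ?_ hab)
      · rw [q.2]; exact ZMod.val_lt a
      · rw [q.2]; exact ZMod.val_lt b⟩, q.1.1, fun i => by
      exact apply_iterate_zmod_val q.2 i⟩
  invFun p := ⟨(p.2.1, p.1 0), by
    have h : Function.Semiconj p.1 (fun x : ZMod j => x + 1) p.2.1.1 := fun i => (p.2.2 i).symm
    change Function.minimalPeriod p.2.1.1 (p.1 0) = j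
    rw [minimalPeriod_eq_of_injective_semiconj p.1.injective h, minimalPeriod_add_one]⟩
  left_inv q := by
    ext1; ext1
    · rfl
    · change q.1.1.1^[(0 : ZMod j).val] q.1.2 = q.1.2
      rw [ZMod.val_zero]; rfl
  right_inv p := by
    obtain ⟨w, σ, hσ⟩ := p
    have hw : ∀ i : ZMod j, σ.1^[i.val] (w 0) = w i := by
      have : ∀ n : ℕ, σ.1^[n] (w 0) = w n := fun n => by
        induction n with
        | zero => simp
        | succ n ih => rw [Function.iterate_succ_apply', ih, hσ]; push_cast; rfl
      intro i
      rw [this, ZMod.natCast_zmod_val]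
    have : (⟨fun i => σ.1^[i.val] (w 0), fun a b hab => by
        simpa [hw] using hab⟩ : ZMod j ↪ α) = w := by
      ext i
      exact hw i
    refine Sigma.ext this ?_
    -- The permutations on the two sides are equal, but are subtyped over different words; only the
    -- equivalence of the two predicates is left to check.
    refine (Subtype.heq_iff_coe_eq fun τ => ?_).mpr rfl
    simp [hw]

open Classical in
/-- A permutation that rotates the word `w` is determined by its action off that word. -/
noncomputable def rotatingPermEquiv (k : ℕ) {j : ℕ} (hjk : j ≤ k) (w : ZMod j ↪ α) :
    {σ : PermCyclesLe α k // ∀ i, σ.1 (w i) = w (i + 1)} ≃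
      PermCyclesLe {x // ¬ x ∈ Set.range w} k where
  toFun σ :=
    -- As `σ` rotates the word, it preserves its range, hence also the complement.
    have hr : ∀ x, x ∉ Set.range w ↔ σ.1.1 x ∉ Set.range w := fun x => by
      refine not_congr ⟨?_, ?_⟩
      · rintro ⟨i, rfl⟩
        exact ⟨i + 1, (σ.2 i).symm⟩
      · rintro ⟨i, hi⟩
        refine ⟨i - 1, σ.1.1.injective ?_⟩
        rw [σ.2, sub_add_cancel, hi]
    ⟨σ.1.1.subtypePerm fun x => (hr x).symm, fun x => by
      have h : Function.Semiconj (Subtype.val : {x // ¬ x ∈ Set.range w} → α)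
        (σ.1.1.subtypePerm fun x => (hr x).symm) σ.1.1 := fun _ => rfl
      rw [← minimalPeriod_eq_of_injective_semiconj Subtype.val_injective h]
      exact σ.1.2 _⟩
  invFun τ :=
    let c : Equiv.Perm {x // x ∈ Set.range w} :=
      (Equiv.ofInjective w w.injective).permCongr (Equiv.addRight 1)
    have hc : ∀ i, Equiv.Perm.subtypeCongr c τ.1 (w i) = w (i + 1) := fun i => by
      rw [Equiv.Perm.subtypeCongr.left_apply _ _ (Set.mem_range_self i)]
      have : (⟨w i, Set.mem_range_self i⟩ : Set.range w) = Equiv.ofInjective w w.injective i := rfl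
      rw [this, Equiv.permCongr_apply, Equiv.symm_apply_apply]
      rfl
    ⟨⟨Equiv.Perm.subtypeCongr c τ.1, fun x => by
      by_cases hx : x ∈ Set.range w
      · obtain ⟨i, rfl⟩ := hx
        have h : Function.Semiconj w (fun x : ZMod j => x + 1) (Equiv.Perm.subtypeCongr c τ.1) :=
          fun i => (hc i).symm
        rw [minimalPeriod_eq_of_injective_semiconj w.injective h, minimalPeriod_add_one]
        -- The prescribed cycle itself must respect the bound `k`; the other cycles are those of
        -- `τ`.
        exact hjk
      · have h : Function.Semiconj (Subtype.val : {x // ¬ x ∈ Set.range w} → α) τ.1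
            (Equiv.Perm.subtypeCongr c τ.1) :=
          fun x => (Equiv.Perm.subtypeCongr.right_apply_subtype c τ.1 x).symm
        exact (minimalPeriod_eq_of_injective_semiconj Subtype.val_injective h ⟨x, hx⟩).trans_le
          (τ.2 _)⟩, hc⟩
  left_inv σ := by
    ext x
    by_cases hx : x ∈ Set.range w
    · obtain ⟨i, rfl⟩ := hx
      rw [σ.2]
      change Equiv.Perm.subtypeCongr _ _ (w i) = _
      rw [Equiv.Perm.subtypeCongr.left_apply _ _ (Set.mem_range_self i)]
      have : (⟨w i, Set.mem_range_self i⟩ : Set.range w) = Equiv.ofInjective w w.injective i := rfl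
      rw [this, Equiv.permCongr_apply, Equiv.symm_apply_apply]
      rfl
    · change Equiv.Perm.subtypeCongr _ _ x = _
      rw [Equiv.Perm.subtypeCongr.right_apply _ _ hx]
      rfl
  right_inv τ := by
    ext x
    change Equiv.Perm.subtypeCongr _ _ x.1 = _
    rw [Equiv.Perm.subtypeCongr.right_apply_subtype]

/-- The falling factorial counts the parametrised cycles `ZMod j ↪ α`; the second factor counts the
permutations of the remaining letters. -/
theorem card_pointedCycle (α : Type*) [Finite α] {k j : ℕ} (hj : j ≠ 0) (hjk : j ≤ k) :
    Nat.card {q : PermCyclesLe α k × α // Function.minimalPeriod q.1.1 q.2 = j} =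
      (Nat.card α).descFactorial j * numPermCyclesLe (Nat.card α - j) k := by
  have : NeZero j := ⟨hj⟩
  have := Fintype.ofFinite α
  have := Fintype.ofFinite (ZMod j ↪ α)
  rw [Nat.card_congr (pointedCycleEquiv α k j), Nat.card_sigma]
  have h : ∀ w : ZMod j ↪ α,
      Nat.card {σ : PermCyclesLe α k // ∀ i, σ.1 (w i) = w (i + 1)} =
        numPermCyclesLe (Nat.card α - j) k := fun w => by
    rw [Nat.card_congr (rotatingPermEquiv k hjk w), card_permCyclesLe]
    congr 1
    change Nat.card ↥(Set.range w)ᶜ = _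
    rw [Nat.card_coe_set_eq, Set.ncard_compl, Set.ncard_range_of_injective w.injective,
      Nat.card_zmod]
  simp only [h, Finset.sum_const, smul_eq_mul, Finset.card_univ]
  rw [Fintype.card_embedding_eq, ZMod.card, Nat.card_eq_fintype_card]

/-- Both sides count pairs of a permutation and a letter; the right side sorts them by the length
`j` of the cycle through the letter. -/
theorem mul_numPermCyclesLe (m k : ℕ) :
    m * numPermCyclesLe m k =
      ∑ j ∈ Finset.Icc 1 k, m.descFactorial j * numPermCyclesLe (m - j) k := by
  classical
  have := Fintype.ofFinite (PermCyclesLe (Fin m) k)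
  have hmaps : ∀ q ∈ (Finset.univ : Finset (PermCyclesLe (Fin m) k × Fin m)),
      Function.minimalPeriod q.1.1 q.2 ∈ Finset.Icc 1 k := fun q _ =>
    Finset.mem_Icc.mpr ⟨Function.minimalPeriod_pos_of_mem_periodicPts
      (mem_periodicPts_perm q.1.1 q.2), q.1.2 q.2⟩
  have h := Finset.card_eq_sum_card_fiberwise hmaps
  rw [Finset.card_univ, Fintype.card_prod, Fintype.card_fin, mul_comm] at h
  rw [numPermCyclesLe, Nat.card_eq_fintype_card, h]
  refine Finset.sum_congr rfl fun j hj => ?_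
  rw [Finset.mem_Icc] at hj
  have := card_pointedCycle (Fin m) (Nat.one_le_iff_ne_zero.mp hj.1) hj.2
  rw [Nat.card_eq_fintype_card, Fintype.card_subtype, Nat.card_fin] at this
  exact this

end Recurrence

/-! ### Mappings as permutations with rooted forests -/

section Mappings

variable {α : Type*}

open Classical in
/-- The mapping that is the permutation `σ` on `C` and `f` off `C`. -/
noncomputable def glueMap {C : Set α} (σ : Equiv.Perm C) (f : {x // x ∉ C} → α) (x : α) : α :=
  if h : x ∈ C then σ ⟨x, h⟩ else f ⟨x, h⟩

theorem glueMap_of_mem {C : Set α} (σ : Equiv.Perm C) (f : {x // x ∉ C} → α) (x : C) :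
    glueMap σ f x = σ x := by
  simp [glueMap]

theorem glueMap_of_notMem {C : Set α} (σ : Equiv.Perm C) (f : {x // x ∉ C} → α) {x : α}
    (hx : x ∉ C) : glueMap σ f x = f ⟨x, hx⟩ := by
  simp [glueMap, hx]

theorem exists_iterate_mem_periodicPts [Finite α] (φ : α → α) (x : α) :
    ∃ n, φ^[n] x ∈ Function.periodicPts φ := by
  obtain ⟨a, b, hab, h⟩ := Finite.exists_ne_map_eq_of_infinite fun n : ℕ => φ^[n] x
  wlog hlt : a < b generalizing a b
  · exact this b a hab.symm h.symm (lt_of_le_of_ne (not_lt.mp hlt) hab.symm)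
  refine ⟨a, Function.mk_mem_periodicPts (n := b - a) (by omega) ?_⟩
  rw [Function.IsPeriodicPt, Function.IsFixedPt, ← Function.iterate_add_apply,
    Nat.sub_add_cancel hlt.le]
  exact h.symm

/-- Points of `C` are always periodic, as `σ` permutes them. An orbit that enters `C` never leaves
it, so a periodic point whose orbit meets `C` lies in `C`. -/
theorem periodicPts_glueMap_eq_iff [Finite α] {C : Set α} (σ : Equiv.Perm C)
    (f : {x // x ∉ C} → α) :
    Function.periodicPts (glueMap σ f) = C ↔ ∀ x, ∃ n, (glueMap σ f)^[n] x ∈ C := by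
  have hsemi : Function.Semiconj (Subtype.val : C → α) σ (glueMap σ f) :=
    fun x => (glueMap_of_mem σ f x).symm
  refine ⟨fun h x => ?_, fun h => Set.Subset.antisymm (fun x hx => ?_) fun x hx => ?_⟩
  · obtain ⟨n, hn⟩ := exists_iterate_mem_periodicPts (glueMap σ f) x
    rw [h] at hn
    exact ⟨n, hn⟩
  · obtain ⟨n, hn⟩ := h x
    have hstay : ∀ k, (glueMap σ f)^[k] ((glueMap σ f)^[n] x) ∈ C := fun k => by
      have := (hsemi.iterate_right k).eq ⟨_, hn⟩
      rw [← this]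
      exact Subtype.coe_prop _
    obtain ⟨p, hp, hpx⟩ := hx
    -- Running through the period `n` times returns to `x` after at least `n` steps, that is, after
    -- the orbit has entered `C`.
    have hnp : n ≤ p * n := Nat.le_mul_of_pos_left n hp
    have := hstay (p * n - n)
    rw [← Function.iterate_add_apply, Nat.sub_add_cancel hnp] at this
    rwa [(hpx.mul_const n).eq] at this
  · exact hsemi.mapsTo_periodicPts (mem_periodicPts_perm σ ⟨x, hx⟩)

/-- Until it first meets `C`, an orbit is governed by `f` alone. This is why the condition on the
forest does not involve the permutation. -/
theorem exists_iterate_glueMap_mem_of_exists {C : Set α} (σ τ : Equiv.Perm C)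
    (f : {x // x ∉ C} → α) (n : ℕ) (x : α) (h : (glueMap σ f)^[n] x ∈ C) :
    ∃ k, (glueMap τ f)^[k] x ∈ C := by
  induction n generalizing x with
  | zero => exact ⟨0, h⟩
  | succ n ih =>
    by_cases hx : x ∈ C
    · exact ⟨0, hx⟩
    · rw [Function.iterate_succ_apply, glueMap_of_notMem σ f hx] at h
      obtain ⟨k, hk⟩ := ih _ h
      refine ⟨k + 1, ?_⟩
      rwa [Function.iterate_succ_apply, glueMap_of_notMem τ f hx]

theorem periodicPts_glueMap_eq_iff_one [Finite α] {C : Set α} (σ : Equiv.Perm C)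
    (f : {x // x ∉ C} → α) :
    Function.periodicPts (glueMap σ f) = C ↔ Function.periodicPts (glueMap 1 f) = C := by
  rw [periodicPts_glueMap_eq_iff, periodicPts_glueMap_eq_iff]
  exact ⟨fun h x => (h x).elim fun n hn => exists_iterate_glueMap_mem_of_exists σ 1 f n x hn,
    fun h x => (h x).elim fun n hn => exists_iterate_glueMap_mem_of_exists 1 σ f n x hn⟩

/-- A mapping with cyclic set `C` consists of a permutation of `C` and of a forest that is
rooted at `C`. -/
noncomputable def mappingEquiv [Finite α] (C : Set α) :
    {φ : α → α // Function.periodicPts φ = C} ≃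
      Equiv.Perm C × {f : {x // x ∉ C} → α // Function.periodicPts (glueMap 1 f) = C} :=
  have hbij : ∀ φ : {φ : α → α // Function.periodicPts φ = C}, Set.BijOn φ.1 C C := fun φ => by
    have := Function.bijOn_periodicPts φ.1
    rwa [φ.2] at this
  have hglue : ∀ φ : {φ : α → α // Function.periodicPts φ = C},
      glueMap ((hbij φ).equiv φ.1) (fun x => φ.1 x) = φ.1 := fun φ => by
    ext x
    by_cases hx : x ∈ C
    · exact glueMap_of_mem _ _ ⟨x, hx⟩
    · exact glueMap_of_notMem _ _ hx
  { toFun := fun φ => ((hbij φ).equiv φ.1, ⟨fun x => φ.1 x, by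
      rw [← periodicPts_glueMap_eq_iff_one ((hbij φ).equiv φ.1), hglue, φ.2]⟩)
    invFun := fun p => ⟨glueMap p.1 p.2.1, (periodicPts_glueMap_eq_iff_one p.1 p.2.1).mpr p.2.2⟩
    left_inv := fun φ => Subtype.ext (hglue φ)
    right_inv := fun p => by
      refine Prod.ext ?_ (Subtype.ext ?_)
      · ext x
        exact glueMap_of_mem p.1 p.2.1 x
      · ext x
        exact glueMap_of_notMem p.1 p.2.1 x.2 }

theorem mappingEquiv_symm_apply [Finite α] (C : Set α) (p) (x : C) :
    ((mappingEquiv C).symm p).1 x = p.1 x :=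
  glueMap_of_mem p.1 p.2.1 x

variable [Fintype α]

open Classical in
/-- The permutation that a uniform random mapping with a given cyclic set induces on this set is
uniform. -/
theorem factorial_mul_sum_periodicPts (C : Finset α) (h : (α → α) → ℕ)
    (H : Equiv.Perm (C : Set α) → ℕ)
    (hH : ∀ (φ : α → α) (σ : Equiv.Perm (C : Set α)), Function.periodicPts φ = C →
      (∀ x : (C : Set α), (σ x : α) = φ x) → h φ = H σ) :
    C.card.factorial * ∑ φ : α → α with Function.periodicPts φ = C, h φ =
      Fintype.card {φ : α → α // Function.periodicPts φ = C} * ∑ σ, H σ := by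
  have key : ∑ φ : α → α with Function.periodicPts φ = C, h φ =
      Fintype.card {f : {x // x ∉ (C : Set α)} → α //
        Function.periodicPts (glueMap 1 f) = C} * ∑ σ, H σ := by
    rw [Finset.sum_subtype (p := fun φ : α → α => Function.periodicPts φ = C) _ (by simp),
      ← (mappingEquiv (C : Set α)).symm.sum_comp, Fintype.sum_prod_type_right]
    rw [← smul_eq_mul, ← Finset.card_univ, ← Finset.sum_const]
    refine Finset.sum_congr rfl fun f _ => Finset.sum_congr rfl fun σ _ => ?_
    exact hH _ _ ((mappingEquiv (C : Set α)).symm (σ, f)).2 fun x => (mappingEquiv_symm_apply (C : Set α) (σ, f) x).symm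
  rw [key, Fintype.card_congr (mappingEquiv (C : Set α)), Fintype.card_prod, Fintype.card_perm]
  simp only [Finset.coe_sort_coe, Fintype.card_coe]
  ring

open Classical in
theorem factorial_mul_card_mapping_cyclesLe (C : Finset α) (k : ℕ) :
    C.card.factorial * Fintype.card {φ : α → α // Function.periodicPts φ = C ∧
        ∀ x, Function.minimalPeriod φ x ≤ k} =
      Fintype.card {φ : α → α // Function.periodicPts φ = C} * numPermCyclesLe C.card k := by
  have := factorial_mul_sum_periodicPts C
    (fun φ => if ∀ x, Function.minimalPeriod φ x ≤ k then 1 else 0)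
    (fun σ => if ∀ x, Function.minimalPeriod σ x ≤ k then 1 else 0) (fun φ σ hφ hσ => by
      have hsemi : Function.Semiconj (Subtype.val : ↥(C : Set α) → α) σ φ := hσ
      have : (∀ x, Function.minimalPeriod φ x ≤ k) ↔ ∀ x, Function.minimalPeriod σ x ≤ k := by
        refine ⟨fun H x => ?_, fun H x => ?_⟩
        · rw [← minimalPeriod_eq_of_injective_semiconj Subtype.val_injective hsemi]
          exact H x
        · by_cases hx : x ∈ (C : Set α)
          · exact (minimalPeriod_eq_of_injective_semiconj Subtype.val_injective hsemi
              ⟨x, hx⟩).trans_le (H _)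
          -- Off the cyclic set the minimal period is `0` by convention, so such points impose no
          -- constraint.
          · rw [← hφ] at hx
            rw [Function.minimalPeriod_eq_zero_of_notMem_periodicPts hx]
            exact Nat.zero_le k
      simp only [this])
  rw [Finset.sum_boole, Finset.sum_boole, Finset.filter_filter] at this
  simp only [Nat.cast_id] at this
  rw [Fintype.card_subtype, this]
  congr 1
  rw [← Fintype.card_subtype, ← Nat.card_eq_fintype_card, card_permCyclesLe]
  simp

open Classical in
theorem card_mapping_fixing (S : Finset α) :
    Fintype.card {φ : α → α // ∀ x ∈ S, φ x = x} =
      Fintype.card α ^ (Fintype.card α - S.card) := by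
  have : (Finset.univ.filter fun φ : α → α => ∀ x ∈ S, φ x = x) =
      Fintype.piFinset fun x => if x ∈ S then {x} else Finset.univ := by
    ext φ
    simp only [Finset.mem_filter, Finset.mem_univ, true_and, Fintype.mem_piFinset]
    refine forall_congr' fun x => ?_
    by_cases hx : x ∈ S <;> simp [hx]
  rw [Fintype.card_subtype, this, Fintype.card_piFinset]
  have h : ∀ x, (if x ∈ S then {x} else Finset.univ : Finset α).card =
      if x ∈ S then 1 else Fintype.card α := fun x => by
    split_ifs <;> simp
  simp only [h]
  rw [Finset.prod_ite]
  simp [Finset.filter_not, Finset.card_sdiff]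

open Classical in
theorem card_perm_fixing (S : Finset α) :
    Fintype.card {σ : Equiv.Perm α // ∀ x ∈ S, σ x = x} =
      (Fintype.card α - S.card).factorial := by
  rw [← Fintype.card_coe S, ← Fintype.card_subtype_compl, ← Fintype.card_perm]
  refine Fintype.card_congr (Equiv.trans (Equiv.subtypeEquivRight fun σ => ?_)
    (Equiv.Perm.subtypeEquivSubtypePerm fun x => x ∉ S).symm)
  simp

open Classical in
/-- Double counting of the sets of `m` fixed points over a family of mappings. -/
theorem sum_choose_fixed {ι : Type*} [Fintype ι] (F : ι → α → α) (m c : ℕ)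
    (hc : ∀ S : Finset α, S.card = m → Fintype.card {i // ∀ x ∈ S, F i x = x} = c) :
    ∑ i, (Finset.univ.filter fun x => F i x = x).card.choose m =
      (Fintype.card α).choose m * c := by
  have : ∀ i, (Finset.univ.filter fun x => F i x = x).card.choose m =
      ∑ S ∈ Finset.powersetCard m (Finset.univ : Finset α),
        if ∀ x ∈ S, F i x = x then 1 else 0 := fun i => by
    rw [← Finset.card_powersetCard, Finset.sum_boole, Nat.cast_id]
    congr 1
    ext S
    simp [Finset.mem_powersetCard, Finset.subset_iff, and_comm]
  simp only [this]
  rw [Finset.sum_comm, ← Finset.card_univ, ← Finset.card_powersetCard, ← smul_eq_mul,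
    ← Finset.sum_const]
  refine Finset.sum_congr rfl fun S hS => ?_
  rw [Finset.sum_boole, Nat.cast_id, ← Fintype.card_subtype]
  exact hc S (Finset.mem_powersetCard.mp hS).2

-- Fixed points of `φ` are exactly those of the permutation induced on `C`. For a uniform
-- permutation of `c` letters the `m`-th factorial moment of the number of fixed points is `c.choose
-- m * m! * (c - m)! / c! = 1` when `m ≤ c`. This moment therefore serves as the indicator of having
-- at least `m` cyclic points.
open Classical in
theorem factorial_mul_sum_choose_fixed (C : Finset α) (m : ℕ) :
    m.factorial * ∑ φ : α → α with Function.periodicPts φ = C,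
        (Finset.univ.filter fun x => φ x = x).card.choose m =
      if m ≤ C.card then Fintype.card {φ : α → α // Function.periodicPts φ = C} else 0 := by
  have h := factorial_mul_sum_periodicPts C
    (fun φ => (Finset.univ.filter fun x => φ x = x).card.choose m)
    (fun σ => (Finset.univ.filter fun x => σ x = x).card.choose m) (fun φ σ hφ hσ => by
      congr 1
      symm
      refine Finset.card_bij (fun x _ => x.1) ?_ (fun _ _ _ _ h => Subtype.ext h) ?_
      · intro x hx
        have : σ x = x := by simpa using hx
        simp [← hσ, this]
      · intro x hx
        have hx : φ x = x := by simpa using hx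
        have hxC : x ∈ (C : Set α) := hφ ▸ Function.mk_mem_periodicPts one_pos hx
        refine ⟨⟨x, hxC⟩, ?_, rfl⟩
        have := hσ ⟨x, hxC⟩
        simp only [Finset.mem_filter, Finset.mem_univ, true_and]
        exact Subtype.ext (this.trans hx))
  have hcard : Fintype.card (C : Set α) = C.card := by simp
  have hperm : ∑ σ : Equiv.Perm (C : Set α), (Finset.univ.filter fun x => σ x = x).card.choose m =
      C.card.choose m * (C.card - m).factorial := by
    have := sum_choose_fixed (fun σ : Equiv.Perm (C : Set α) => ⇑σ) m (C.card - m).factorial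
      (fun S hS => by
        have := card_perm_fixing S
        rw [hS, hcard] at this
        convert this)
    rw [hcard] at this
    convert this
  rw [hperm] at h
  split_ifs with hm
  · refine Nat.eq_of_mul_eq_mul_left (Nat.factorial_pos C.card) ?_
    rw [mul_left_comm, h, ← Nat.choose_mul_factorial_mul_factorial hm]
    ring
  · rw [Nat.choose_eq_zero_of_lt (not_le.mp hm), zero_mul, mul_zero] at h
    rw [(Nat.mul_eq_zero.mp h).resolve_left (Nat.factorial_ne_zero _), mul_zero]

open Classical in
/-- A sum over mappings, grouped by the set of cyclic points. -/
theorem sum_mapping_eq_sum_periodicPts (h : (α → α) → ℕ) :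
    ∑ φ, h φ = ∑ C : Finset α, ∑ φ : α → α with Function.periodicPts φ = C, h φ := by
  rw [← Finset.sum_fiberwise_of_maps_to (s := Finset.univ) (t := Finset.univ)
    (g := fun φ : α → α => (Function.periodicPts φ).toFinset) (fun _ _ => Finset.mem_univ _)]
  refine Finset.sum_congr rfl fun C _ => Finset.sum_congr ?_ fun _ _ => rfl
  ext φ
  simp only [Finset.mem_filter, Finset.mem_univ, true_and]
  rw [← Finset.coe_inj, Set.coe_toFinset]

-- The sum of `m! * (number of fixed points).choose m` over all mappings is evaluated twice: by
-- cyclic set it counts the mappings with at least `m` cyclic points, and by sets of `m` fixed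
-- points it is explicit.
open Classical in
theorem card_le_ncard_periodicPts (m : ℕ) :
    Nat.card {φ : α → α // m ≤ (Function.periodicPts φ).ncard} =
      (Fintype.card α).descFactorial m * Fintype.card α ^ (Fintype.card α - m) := by
  rw [Nat.card_eq_fintype_card]
  have h1 := sum_choose_fixed (fun φ : α → α => φ) m _
    (fun S hS => hS ▸ card_mapping_fixing S)
  have h2 : m.factorial * ∑ φ : α → α, (Finset.univ.filter fun x => φ x = x).card.choose m =
      Fintype.card {φ : α → α // m ≤ (Function.periodicPts φ).ncard} := by
    rw [sum_mapping_eq_sum_periodicPts, Finset.mul_sum, Fintype.card_subtype, Finset.card_filter,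
      sum_mapping_eq_sum_periodicPts]
    refine Finset.sum_congr rfl fun C _ => ?_
    rw [factorial_mul_sum_choose_fixed, Fintype.card_subtype, Finset.card_filter]
    rw [← Finset.sum_filter]
    have : ∀ φ ∈ Finset.univ.filter (fun φ : α → α => Function.periodicPts φ = C),
        (if m ≤ (Function.periodicPts φ).ncard then 1 else 0) = if m ≤ C.card then 1 else 0 := by
      intro φ hφ
      rw [(Finset.mem_filter.mp hφ).2, Set.ncard_coe_finset]
    rw [Finset.sum_congr rfl this]
    split_ifs <;> simp
  rw [← h2, h1, ← mul_assoc, ← Nat.descFactorial_eq_factorial_mul_choose]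

open Classical in
/-- Among the mappings with `m` cyclic points, the proportion of those without cycles longer than
`k` is the same as among the permutations of `m` letters. -/
theorem factorial_mul_card_ncard_eq_cyclesLe (m k : ℕ) :
    m.factorial * Nat.card {φ : α → α // (Function.periodicPts φ).ncard = m ∧
        ∀ x, Function.minimalPeriod φ x ≤ k} =
      Nat.card {φ : α → α // (Function.periodicPts φ).ncard = m} * numPermCyclesLe m k := by
  rw [Nat.card_eq_fintype_card, Nat.card_eq_fintype_card,
    Fintype.card_subtype, Fintype.card_subtype, Finset.card_filter, Finset.card_filter,
    sum_mapping_eq_sum_periodicPts, sum_mapping_eq_sum_periodicPts, Finset.mul_sum, Finset.sum_mul]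
  refine Finset.sum_congr rfl fun C _ => ?_
  have hC := factorial_mul_card_mapping_cyclesLe C k
  have e1 : ∀ φ ∈ Finset.univ.filter (fun φ : α → α => Function.periodicPts φ = C),
      (if (Function.periodicPts φ).ncard = m ∧ ∀ x, Function.minimalPeriod φ x ≤ k then 1 else 0) =
        if C.card = m ∧ ∀ x, Function.minimalPeriod φ x ≤ k then 1 else 0 := by
    intro φ hφ
    rw [(Finset.mem_filter.mp hφ).2, Set.ncard_coe_finset]
  have e2 : ∀ φ ∈ Finset.univ.filter (fun φ : α → α => Function.periodicPts φ = C),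
      (if (Function.periodicPts φ).ncard = m then 1 else 0) = if C.card = m then 1 else 0 := by
    intro φ hφ
    rw [(Finset.mem_filter.mp hφ).2, Set.ncard_coe_finset]
  rw [Finset.sum_congr rfl e1, Finset.sum_congr rfl e2]
  by_cases hm : C.card = m
  · subst hm
    rw [Fintype.card_subtype, Fintype.card_subtype] at hC
    simp only [true_and, if_true, Finset.sum_const, smul_eq_mul, mul_one]
    rw [← hC, Finset.sum_boole, Nat.cast_id, Finset.filter_filter]
  · simp [hm]

end Mappings

/-! ### Permutations without long cycles: convergence to Dickman's function -/

/-- The probability that a uniform random permutation of `m` letters has no cycle longer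
than `k`. -/
noncomputable def permCyclesLeProb (m k : ℕ) : ℝ := numPermCyclesLe m k / m.factorial

theorem permCyclesLeProb_nonneg (m k : ℕ) : 0 ≤ permCyclesLeProb m k := by
  unfold permCyclesLeProb
  positivity

theorem permCyclesLeProb_le_one (m k : ℕ) : permCyclesLeProb m k ≤ 1 := by
  rw [permCyclesLeProb, div_le_one (by positivity)]
  exact_mod_cast numPermCyclesLe_le m k

theorem permCyclesLeProb_of_le {m k : ℕ} (h : m ≤ k) : permCyclesLeProb m k = 1 := by
  rw [permCyclesLeProb, numPermCyclesLe_of_le h, div_self (by positivity)]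

/-- This is `mul_numPermCyclesLe` divided by `m!`, with `i = m - j`: the discrete counterpart of
`mul_dickman_eq_integral`. -/
theorem mul_permCyclesLeProb {m k : ℕ} (h : k ≤ m) :
    m * permCyclesLeProb m k = ∑ i ∈ Finset.Ico (m - k) m, permCyclesLeProb i k := by
  have hrec : (m : ℝ) * numPermCyclesLe m k =
      ∑ j ∈ Finset.Icc 1 k, (m.descFactorial j * numPermCyclesLe (m - j) k : ℝ) := by
    exact_mod_cast mul_numPermCyclesLe m k
  rw [permCyclesLeProb, ← mul_div_assoc, hrec, Finset.sum_div]
  refine Finset.sum_nbij' (fun j => m - j) (fun i => m - i) ?_ ?_ ?_ ?_ ?_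
  · intro j hj
    simp only [Finset.mem_Icc, Finset.mem_Ico] at hj ⊢
    omega
  · intro j hj
    simp only [Finset.mem_Icc, Finset.mem_Ico] at hj ⊢
    omega
  · intro j hj
    simp only [Finset.mem_Icc] at hj
    omega
  · intro j hj
    simp only [Finset.mem_Ico] at hj
    omega
  · intro j hj
    simp only [Finset.mem_Icc] at hj
    have hfac : ((m - j).factorial : ℝ) * m.descFactorial j = m.factorial := by
      exact_mod_cast Nat.factorial_mul_descFactorial (hj.2.trans h)
    have : (m.descFactorial j : ℝ) ≠ 0 := by
      have := (Nat.descFactorial_pos (n := m)).mpr (hj.2.trans h)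
      positivity
    rw [permCyclesLeProb, ← hfac]
    field_simp

/-- The discrete analogue of `mul_dickman_eq_integral` holds up to an error of at most `1`. -/
theorem abs_sum_dickman_sub_le {m k : ℕ} (hk : 0 < k) (h : k ≤ m) :
    |∑ i ∈ Finset.Ico (m - k) m, dickman (i / k) - m * dickman (m / k)| ≤ 1 := by
  have hk' : (0 : ℝ) < k := by exact_mod_cast hk
  have hanti : AntitoneOn (fun x : ℝ => dickman (x / k)) (Set.Icc ((m - k : ℕ) : ℝ) m) := by
    intro x hx y hy hxy
    have hx0 : 0 ≤ x := le_trans (Nat.cast_nonneg _) hx.1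
    exact antitoneOn_dickman (Set.mem_Ici.mpr (by positivity))
      (Set.mem_Ici.mpr (div_nonneg (hx0.trans hxy) hk'.le)) (by gcongr)
  have hint : ∫ x in ((m - k : ℕ) : ℝ)..m, dickman (x / k) = m * dickman (m / k) := by
    rw [intervalIntegral.integral_comp_div (fun x => dickman x) hk'.ne', smul_eq_mul,
      Nat.cast_sub h, sub_div, div_self hk'.ne', ← mul_dickman_eq_integral]
    · field_simp
    · rw [one_le_div hk']
      exact_mod_cast h
  have h1 := hanti.integral_le_sum_Ico (Nat.sub_le m k)
  have h2 := hanti.sum_le_integral_Ico (Nat.sub_le m k)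
  -- The upper and lower Riemann sums of the decreasing integrand enclose the integral; their
  -- difference telescopes to a difference of two values of `ρ` in `[0, 1]`.
  have h3 : ∑ i ∈ Finset.Ico (m - k) m, dickman (i / k) -
      ∑ i ∈ Finset.Ico (m - k) m, dickman (((i + 1 : ℕ) : ℝ) / k) =
        dickman ((m - k : ℕ) / k) - dickman (m / k) := by
    have := Finset.sum_Ico_sub (fun i : ℕ => dickman ((i : ℝ) / k)) (Nat.sub_le m k)
    rw [Finset.sum_sub_distrib] at this
    linarith
  rw [hint] at h1 h2
  have := dickman_le_one ((m - k : ℕ) / k)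
  have := dickman_nonneg (m / k)
  rw [abs_le]
  constructor <;> linarith

/-- For `m > k`, `m` times the error at `m` is at most the sum of the `k` preceding errors plus `1`.
The bound is chosen so that its sum over all `i < m` is `(1 + 1 / k) ^ m - 1`, which absorbs the
extra `1`; division by `m ≥ k` closes the induction. For `m ≤ k` the error is zero. -/
theorem abs_permCyclesLeProb_sub_dickman_le {k : ℕ} (hk : 0 < k) (m : ℕ) :
    |permCyclesLeProb m k - dickman (m / k)| ≤ (1 + 1 / k : ℝ) ^ m / k := by
  have hk' : (0 : ℝ) < k := by exact_mod_cast hk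
  induction m using Nat.strong_induction_on with
  | _ m ih =>
  rcases le_or_gt m k with h | h
  · rw [permCyclesLeProb_of_le h, dickman_of_mem_Icc (by positivity)
      (by rw [div_le_one hk']; exact_mod_cast h), sub_self, abs_zero]
    positivity
  · have hm : (0 : ℝ) < m := by exact_mod_cast hk.trans h
    have hkm : (k : ℝ) ≤ m := by exact_mod_cast h.le
    have hgeom : ∑ i ∈ Finset.Ico (m - k) m, (1 + 1 / k : ℝ) ^ i / k ≤
        (1 + 1 / k : ℝ) ^ m - 1 := by
      calc ∑ i ∈ Finset.Ico (m - k) m, (1 + 1 / k : ℝ) ^ i / k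
          ≤ ∑ i ∈ Finset.range m, (1 + 1 / k : ℝ) ^ i / k := by
            refine Finset.sum_le_sum_of_subset_of_nonneg (fun i hi => ?_) fun _ _ _ => by positivity
            simp only [Finset.mem_Ico, Finset.mem_range] at hi ⊢
            exact hi.2
        _ = (1 + 1 / k : ℝ) ^ m - 1 := by
            rw [← Finset.sum_div, div_eq_mul_one_div]
            have := geom_sum_mul (1 + 1 / k : ℝ) m
            rwa [add_sub_cancel_left] at this
    have hsum : |∑ i ∈ Finset.Ico (m - k) m, permCyclesLeProb i k -
        ∑ i ∈ Finset.Ico (m - k) m, dickman (i / k)| ≤ (1 + 1 / k : ℝ) ^ m - 1 := by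
      rw [← Finset.sum_sub_distrib]
      refine (Finset.abs_sum_le_sum_abs _ _).trans ((Finset.sum_le_sum fun i hi => ?_).trans hgeom)
      exact ih i (Finset.mem_Ico.mp hi).2
    have hd := abs_sum_dickman_sub_le hk h.le
    rw [← mul_permCyclesLeProb h.le] at hsum
    have htri := abs_sub_le (m * permCyclesLeProb m k)
      (∑ i ∈ Finset.Ico (m - k) m, dickman (i / k)) (m * dickman (m / k))
    rw [← mul_sub, abs_mul, abs_of_pos hm] at htri
    have hfin : m * |permCyclesLeProb m k - dickman (m / k)| ≤ (1 + 1 / k : ℝ) ^ m := by linarith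
    rw [le_div_iff₀ hk', mul_comm]
    refine le_trans ?_ hfin
    gcongr

/-- The error is at most `exp (m / k) / k`, where `m / k` converges and `k → ∞`. -/
theorem tendsto_permCyclesLeProb {m k : ℕ → ℕ} {x : ℝ} (hk : Tendsto k atTop atTop)
    (hmk : Tendsto (fun n => (m n : ℝ) / k n) atTop (nhds x)) :
    Tendsto (fun n => permCyclesLeProb (m n) (k n)) atTop (nhds (dickman x)) := by
  have hx : 0 ≤ x := ge_of_tendsto' hmk fun n => by positivity
  have hd : Tendsto (fun n => dickman ((m n : ℝ) / k n)) atTop (nhds (dickman x)) := by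
    refine (continuousOn_dickman x hx).tendsto.comp (tendsto_nhdsWithin_iff.mpr ⟨hmk, ?_⟩)
    exact Eventually.of_forall fun n => Set.mem_Ici.mpr (by positivity)
  have hkr : Tendsto (fun n => (k n : ℝ)) atTop atTop := tendsto_natCast_atTop_atTop.comp hk
  have herr : Tendsto (fun n => Real.exp ((m n : ℝ) / k n) / k n) atTop (nhds 0) :=
    ((Real.continuous_exp.tendsto x).comp hmk).div_atTop hkr
  have hdiff : Tendsto (fun n => permCyclesLeProb (m n) (k n) - dickman ((m n : ℝ) / k n)) atTop
      (nhds 0) := by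
    refine squeeze_zero_norm' ?_ herr
    filter_upwards [hk.eventually_gt_atTop 0] with n hn
    refine (abs_permCyclesLeProb_sub_dickman_le hn (m n)).trans ?_
    have hpow : (1 + 1 / k n : ℝ) ^ (m n) ≤ Real.exp ((m n : ℝ) / k n) := by
      rw [div_eq_mul_one_div (m n : ℝ), Real.exp_nat_mul]
      gcongr
      rw [add_comm]
      exact Real.add_one_le_exp _
    gcongr
  simpa using hdiff.add hd

/-! ### The birthday product and its exponential bounds -/

/-- The probability that the first `m` of a sequence of uniform letters from an alphabet of size `n`
are distinct. -/
noncomputable def distinctProb (n m : ℕ) : ℝ := ∏ i ∈ Finset.range m, (1 - i / n : ℝ)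

theorem descFactorial_eq_distinctProb {n : ℕ} (hn : n ≠ 0) (m : ℕ) :
    (n.descFactorial m : ℝ) = distinctProb n m * n ^ m := by
  have hn' : (n : ℝ) ≠ 0 := by exact_mod_cast hn
  induction m with
  | zero => simp [distinctProb]
  | succ m ih =>
    rw [Nat.descFactorial_succ, distinctProb, Finset.prod_range_succ, ← distinctProb]
    rcases le_or_gt m n with h | h
    · rw [Nat.cast_mul, Nat.cast_sub h, ih, pow_succ]
      field_simp
    · rw [Nat.descFactorial_of_lt h, Nat.cast_zero] at ih
      have : distinctProb n m = 0 := by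
        simpa [hn'] using ih.symm
      rw [this, Nat.descFactorial_of_lt h]
      simp

theorem distinctProb_of_lt {n m : ℕ} (hn : n ≠ 0) (h : n < m) : distinctProb n m = 0 :=
  Finset.prod_eq_zero (Finset.mem_range.mpr h) (by
    rw [div_self (by exact_mod_cast hn), sub_self])

theorem distinctProb_nonneg (n m : ℕ) : 0 ≤ distinctProb n m := by
  rcases eq_or_ne n 0 with rfl | hn
  · simp [distinctProb]
  rcases lt_or_ge n m with h | h
  · rw [distinctProb_of_lt hn h]
  · refine Finset.prod_nonneg fun i hi => ?_
    have hin : (i : ℝ) ≤ n := by exact_mod_cast (Finset.mem_range.mp hi).le.trans h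
    rw [sub_nonneg]
    exact div_le_one_of_le₀ hin (by positivity)

theorem sum_range_cast_div (n m : ℕ) :
    ∑ i ∈ Finset.range m, (i / n : ℝ) = m * (m - 1) / (2 * n) := by
  rw [← Finset.sum_div]
  have : ∑ i ∈ Finset.range m, (i : ℝ) = m * (m - 1) / 2 := by
    induction m with
    | zero => simp
    | succ m ih => rw [Finset.sum_range_succ, ih]; push_cast; ring
  rw [this, div_div]

theorem distinctProb_le_exp {n m : ℕ} (h : m ≤ n) :
    distinctProb n m ≤ Real.exp (-(m * (m - 1) / (2 * n))) := by
  rw [← sum_range_cast_div, ← Finset.sum_neg_distrib, Real.exp_sum]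
  refine Finset.prod_le_prod (fun i hi => ?_) fun i _ => ?_
  · have hin : (i : ℝ) ≤ n := by exact_mod_cast (Finset.mem_range.mp hi).le.trans h
    rw [sub_nonneg]
    exact div_le_one_of_le₀ hin (by positivity)
  · linarith [Real.add_one_le_exp (-(i / n : ℝ))]

/-- Uses `1 - t ≥ exp (-t / (1 - t))` in each factor, with `1 - t` replaced by its lower bound `1 -
m / n`. For `m` of order `√n` this matches `distinctProb_le_exp` in the limit. -/
theorem exp_le_distinctProb {n m : ℕ} (h : m < n) :
    Real.exp (-(m * (m - 1) / (2 * n) / (1 - m / n))) ≤ distinctProb n m := by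
  have hn : (0 : ℝ) < n := by exact_mod_cast (Nat.zero_le m).trans_lt h
  have hr : (0 : ℝ) < 1 - m / n := by
    rw [sub_pos, div_lt_one hn]
    exact_mod_cast h
  rw [← sum_range_cast_div, Finset.sum_div, ← Finset.sum_neg_distrib, Real.exp_sum]
  refine Finset.prod_le_prod (fun i _ => (Real.exp_pos _).le) fun i hi => ?_
  have him : (i : ℝ) ≤ m := by exact_mod_cast (Finset.mem_range.mp hi).le
  have hle : (i / n : ℝ) ≤ m / n := by gcongr
  have hi0 : (0 : ℝ) ≤ i / n := by positivity
  set t : ℝ := i / n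
  have ht : 0 < 1 - t := by linarith
  have h1 : t / (1 - t) ≤ t / (1 - m / n) := by gcongr
  have h2 := Real.add_one_le_exp (t / (1 - t))
  have h3 : t / (1 - t) + 1 = (1 - t)⁻¹ := by field_simp; ring
  rw [Real.exp_neg, inv_le_comm₀ (Real.exp_pos _) ht, ← h3]
  exact h2.trans (Real.exp_le_exp.mpr h1)

/-- The probability that a uniform random mapping of `n` points has `m` cyclic points. -/
noncomputable def cyclicProb (n m : ℕ) : ℝ := m / n * distinctProb n m

theorem cyclicProb_nonneg (n m : ℕ) : 0 ≤ cyclicProb n m :=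
  mul_nonneg (by positivity) (distinctProb_nonneg n m)

theorem cyclicProb_of_lt {n m : ℕ} (hn : n ≠ 0) (h : n < m) : cyclicProb n m = 0 := by
  rw [cyclicProb, distinctProb_of_lt hn h, mul_zero]

/-! ### The exact joint law of the longest cycle and the number of cyclic points -/

theorem uniformMapping_real_apply (n : ℕ) (P : (Fin n → Fin n) → Prop) :
    (uniformMapping n).real {φ | P φ} = Nat.card {φ // P φ} / (n : ℝ) ^ n := by
  classical
  have : ({φ | P φ} : Set (Fin n → Fin n)) = (Finset.univ.filter P : Finset _) := by ext; simp
  rw [measureReal_def, uniformMapping, uniformOn_univ, this, Measure.count_apply_finset,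
    Nat.card_eq_fintype_card, Fintype.card_subtype]
  simp

theorem uniformMapping_le_numCyclicPoints {n : ℕ} (hn : n ≠ 0) (m : ℕ) :
    (uniformMapping n).real {φ | m ≤ numCyclicPoints φ} = distinctProb n m := by
  have hn' : (n : ℝ) ≠ 0 := by exact_mod_cast hn
  have h := card_le_ncard_periodicPts (α := Fin n) m
  rw [Fintype.card_fin] at h
  rw [uniformMapping_real_apply]
  unfold numCyclicPoints
  rw [h, Nat.cast_mul, descFactorial_eq_distinctProb hn, Nat.cast_pow]
  rcases le_or_gt m n with hm | hm
  · rw [mul_assoc, ← pow_add, Nat.add_sub_cancel' hm, mul_div_cancel_right₀ _ (pow_ne_zero _ hn')]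
  · rw [distinctProb_of_lt hn hm]
    simp

/-- The difference of consecutive tails is `distinctProb n m * (1 - (1 - m / n))`. -/
theorem uniformMapping_numCyclicPoints_eq {n : ℕ} (hn : n ≠ 0) (m : ℕ) :
    (uniformMapping n).real {φ | numCyclicPoints φ = m} = cyclicProb n m := by
  have hset : {φ : Fin n → Fin n | numCyclicPoints φ = m} =
      {φ | m ≤ numCyclicPoints φ} \ {φ | m + 1 ≤ numCyclicPoints φ} := by
    ext φ
    simp only [Set.mem_ofPred_eq, Set.mem_sdiff]
    omega
  have hsub : {φ : Fin n → Fin n | m + 1 ≤ numCyclicPoints φ} ⊆ {φ | m ≤ numCyclicPoints φ} :=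
    fun φ (hφ : m + 1 ≤ numCyclicPoints φ) => (Nat.le_succ m).trans hφ
  rw [hset, measureReal_sdiff hsub (Set.toFinite _).measurableSet,
    uniformMapping_le_numCyclicPoints hn, uniformMapping_le_numCyclicPoints hn, cyclicProb,
    distinctProb, distinctProb, Finset.prod_range_succ]
  ring

theorem longestCycle_le_iff {n : ℕ} (φ : Fin n → Fin n) (k : ℕ) :
    longestCycle φ ≤ k ↔ ∀ x, Function.minimalPeriod φ x ≤ k := by
  simp [longestCycle]

theorem uniformMapping_longestCycle_le {n : ℕ} (hn : n ≠ 0) (m k : ℕ) :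
    (uniformMapping n).real {φ | numCyclicPoints φ = m ∧ longestCycle φ ≤ k} =
      cyclicProb n m * permCyclesLeProb m k := by
  have h := factorial_mul_card_ncard_eq_cyclesLe (α := Fin n) m k
  have h' : (m.factorial : ℝ) * Nat.card {φ : Fin n → Fin n // (Function.periodicPts φ).ncard = m ∧
        ∀ x, Function.minimalPeriod φ x ≤ k} =
      Nat.card {φ : Fin n → Fin n // (Function.periodicPts φ).ncard = m} *
        numPermCyclesLe m k := by exact_mod_cast h
  rw [← uniformMapping_numCyclicPoints_eq hn, uniformMapping_real_apply, uniformMapping_real_apply,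
    permCyclesLeProb]
  simp only [longestCycle_le_iff]
  unfold numCyclicPoints
  have : (m.factorial : ℝ) ≠ 0 := by positivity
  rw [div_mul_div_comm, ← h', mul_comm ((n : ℝ) ^ n), mul_div_mul_left _ _ this]

open Classical in
theorem uniformMapping_longestCycle_le_and {n : ℕ} (hn : n ≠ 0) (k : ℕ) (B : ℕ → Prop) :
    (uniformMapping n).real {φ | longestCycle φ ≤ k ∧ B (numCyclicPoints φ)} =
      ∑ m ∈ Finset.range (n + 1), if B m then cyclicProb n m * permCyclesLeProb m k else 0 := by
  have hset : {φ : Fin n → Fin n | longestCycle φ ≤ k ∧ B (numCyclicPoints φ)} =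
      ⋃ m ∈ (Finset.range (n + 1)).filter B,
        {φ | numCyclicPoints φ = m ∧ longestCycle φ ≤ k} := by
    ext φ
    have hle : numCyclicPoints φ ≤ n := by
      simpa [numCyclicPoints] using Set.ncard_le_card (Function.periodicPts φ)
    simp only [Set.mem_ofPred_eq, Finset.mem_filter, Finset.mem_range, Set.mem_iUnion, exists_prop]
    constructor
    · rintro ⟨h1, h2⟩
      exact ⟨_, ⟨by omega, h2⟩, rfl, h1⟩
    · rintro ⟨m, ⟨_, h2⟩, rfl, h1⟩
      exact ⟨h1, h2⟩
  rw [hset, measureReal_biUnion_finset, Finset.sum_filter]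
  · simp only [uniformMapping_longestCycle_le hn]
  · intro i _ j _ hij
    refine Set.disjoint_left.mpr fun φ h1 h2 => hij (h1.1.symm.trans h2.1)
  · exact fun m _ => (Set.toFinite _).measurableSet

theorem longestCycle_pos {n : ℕ} (hn : n ≠ 0) (φ : Fin n → Fin n) : 0 < longestCycle φ := by
  obtain ⟨k, hk⟩ := exists_iterate_mem_periodicPts φ ⟨0, Nat.pos_of_ne_zero hn⟩
  exact (Function.minimalPeriod_pos_of_mem_periodicPts hk).trans_le
    (Finset.le_sup (f := fun x => Function.minimalPeriod φ x) (Finset.mem_univ _))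

/-! ### Local limit and domination for the number of cyclic points -/

/-- A finite sum as the integral of a step function with steps of width `1 / s`. -/
theorem integral_floor_mul {s : ℝ} (hs : 0 < s) {h : ℕ → ℝ} {N : ℕ} (hN : ∀ m, N ≤ m → h m = 0) :
    ∫ v in Set.Ici (0 : ℝ), s * h ⌊v * s⌋₊ = ∑ m ∈ Finset.range N, h m := by
  have hstep : ∀ v ∈ Set.Ici (0 : ℝ), s * h ⌊v * s⌋₊ =
      ∑ m ∈ Finset.range N, (Set.Ico (m / s) ((m + 1) / s)).indicator (fun _ => s * h m) v := by
    intro v hv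
    have hv : 0 ≤ v := hv
    have hiff : ∀ m : ℕ, v ∈ Set.Ico (m / s) ((m + 1) / s) ↔ ⌊v * s⌋₊ = m := fun m => by
      rw [Nat.floor_eq_iff (by positivity), Set.mem_Ico, div_le_iff₀ hs, lt_div_iff₀ hs]
    simp only [Set.indicator_apply, hiff]
    rw [Finset.sum_ite_eq]
    split_ifs with hmem
    · rfl
    · rw [hN _ (by simpa using hmem), mul_zero]
  rw [setIntegral_congr_fun measurableSet_Ici hstep, integral_finsetSum]
  · refine Finset.sum_congr rfl fun m _ => ?_
    have hsub : Set.Ici (0 : ℝ) ∩ Set.Ico (m / s) ((m + 1) / s) = Set.Ico (m / s) ((m + 1) / s) :=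
      Set.inter_eq_right.mpr fun v hv => le_trans (by positivity) hv.1
    rw [setIntegral_indicator measurableSet_Ico, hsub, setIntegral_const, measureReal_def,
      Real.volume_Ico, ENNReal.toReal_ofReal (by rw [← sub_div]; simp [hs.le])]
    rw [smul_eq_mul]
    field_simp
    ring
  · intro m _
    refine ((integrable_indicator_iff measurableSet_Ico).mpr ?_).integrableOn
    exact integrableOn_const (by simp) enorm_ne_top

theorem tendsto_sqrt_natCast_atTop : Tendsto (fun n : ℕ => √(n : ℝ)) atTop atTop :=
  Real.tendsto_sqrt_atTop.comp tendsto_natCast_atTop_atTop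

theorem tendsto_floor_mul_sqrt_div {v : ℝ} (hv : 0 ≤ v) :
    Tendsto (fun n : ℕ => (⌊v * √(n : ℝ)⌋₊ : ℝ) / √(n : ℝ)) atTop (nhds v) :=
  (tendsto_nat_floor_mul_div_atTop hv).comp tendsto_sqrt_natCast_atTop

theorem tendsto_distinctProb {v : ℝ} (hv : 0 ≤ v) :
    Tendsto (fun n : ℕ => distinctProb n ⌊v * √(n : ℝ)⌋₊) atTop
      (nhds (Real.exp (-v ^ 2 / 2))) := by
  have hfl := tendsto_floor_mul_sqrt_div hv
  have hinv : Tendsto (fun n : ℕ => (√(n : ℝ))⁻¹) atTop (nhds 0) :=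
    tendsto_inv_atTop_zero.comp tendsto_sqrt_natCast_atTop
  have hr : Tendsto (fun n : ℕ => (⌊v * √(n : ℝ)⌋₊ : ℝ) / n) atTop (nhds 0) := by
    have := hfl.mul hinv
    rw [mul_zero] at this
    refine this.congr fun n => ?_
    rw [← div_eq_mul_inv, div_div, Real.mul_self_sqrt (Nat.cast_nonneg n)]
  have he : Tendsto (fun n : ℕ => (⌊v * √(n : ℝ)⌋₊ : ℝ) * (⌊v * √(n : ℝ)⌋₊ - 1) / (2 * n)) atTop
      (nhds (v ^ 2 / 2)) := by
    have := (hfl.mul (hfl.sub hinv)).div_const 2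
    rw [sub_zero, ← sq] at this
    refine this.congr' ?_
    filter_upwards [eventually_gt_atTop 0] with n hn
    have hs : (0 : ℝ) < √(n : ℝ) := Real.sqrt_pos.mpr (by exact_mod_cast hn)
    have hsq : (n : ℝ) = √(n : ℝ) * √(n : ℝ) := (Real.mul_self_sqrt (Nat.cast_nonneg n)).symm
    generalize (⌊v * √(n : ℝ)⌋₊ : ℝ) = y
    generalize √(n : ℝ) = s at hs hsq
    rw [hsq]
    field_simp
  have hlt : ∀ᶠ n : ℕ in atTop, ⌊v * √(n : ℝ)⌋₊ < n := by
    filter_upwards [hr.eventually_lt_const zero_lt_one, eventually_gt_atTop 0] with n h hn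
    rw [div_lt_one (by exact_mod_cast hn)] at h
    exact_mod_cast h
  have hlow := he.div (tendsto_const_nhds.sub hr) (by norm_num : (1 : ℝ) - 0 ≠ 0)
  rw [sub_zero, div_one] at hlow
  rw [neg_div]
  refine tendsto_of_tendsto_of_tendsto_of_le_of_le' (Real.continuous_exp.tendsto _ |>.comp hlow.neg)
    (Real.continuous_exp.tendsto _ |>.comp he.neg) ?_ ?_
  · filter_upwards [hlt] with n hn using exp_le_distinctProb hn
  · filter_upwards [hlt] with n hn using distinctProb_le_exp hn.le

theorem sqrt_mul_cyclicProb (n m : ℕ) :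
    √(n : ℝ) * cyclicProb n m = m / √(n : ℝ) * distinctProb n m := by
  rcases Nat.eq_zero_or_pos n with rfl | hn
  · simp [cyclicProb]
  have hs : (0 : ℝ) < √(n : ℝ) := Real.sqrt_pos.mpr (by exact_mod_cast hn)
  have hsq : (n : ℝ) = √(n : ℝ) * √(n : ℝ) := (Real.mul_self_sqrt (Nat.cast_nonneg n)).symm
  rw [cyclicProb, ← mul_assoc]
  congr 1
  generalize √(n : ℝ) = s at hs hsq
  rw [hsq]
  field_simp

/-- The number of cyclic points, divided by `√n`, has asymptotically the Rayleigh density. -/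
theorem tendsto_sqrt_mul_cyclicProb {v : ℝ} (hv : 0 ≤ v) :
    Tendsto (fun n : ℕ => √(n : ℝ) * cyclicProb n ⌊v * √(n : ℝ)⌋₊) atTop
      (nhds (v * Real.exp (-v ^ 2 / 2))) := by
  simp only [sqrt_mul_cyclicProb]
  exact (tendsto_floor_mul_sqrt_div hv).mul (tendsto_distinctProb hv)

/-- An integrable majorant uniform in `n`, for dominated convergence. -/
theorem sqrt_mul_cyclicProb_le {n : ℕ} (hn : n ≠ 0) {v : ℝ} (hv : 0 ≤ v) :
    √(n : ℝ) * cyclicProb n ⌊v * √(n : ℝ)⌋₊ ≤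
      Real.exp (9 / 4) * (v * Real.exp (-(1 / 4) * v ^ 2)) := by
  rcases lt_or_ge n ⌊v * √(n : ℝ)⌋₊ with h | h
  · rw [cyclicProb_of_lt hn h, mul_zero]
    positivity
  have hn1 : (1 : ℝ) ≤ n := by exact_mod_cast Nat.one_le_iff_ne_zero.mpr hn
  have hs : 1 ≤ √(n : ℝ) := Real.one_le_sqrt.mpr hn1
  have hsq : √(n : ℝ) ^ 2 = n := Real.sq_sqrt (Nat.cast_nonneg n)
  have hs0 : 0 < √(n : ℝ) := zero_lt_one.trans_le hs
  have hle : (⌊v * √(n : ℝ)⌋₊ : ℝ) ≤ v * √(n : ℝ) := Nat.floor_le (by positivity)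
  have hlt := Nat.lt_floor_add_one (v * √(n : ℝ))
  have hexp := distinctProb_le_exp h
  have hm0 : (0 : ℝ) ≤ ⌊v * √(n : ℝ)⌋₊ := Nat.cast_nonneg _
  rw [sqrt_mul_cyclicProb]
  set m := ⌊v * √(n : ℝ)⌋₊
  -- The floor costs at most `3 * v * √n ≤ 3 * v * n` in the numerator, so the exponent is at most
  -- `-(v² - 3 * v) / 2`; the constants `9 / 4` and `1 / 4` come from `(v - 3)² ≥ 0`.
  have hquad : -(m * (m - 1) / (2 * n) : ℝ) ≤ 9 / 4 + -(1 / 4) * v ^ 2 := by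
    have h1 : (v * √(n : ℝ)) ^ 2 - 3 * (v * √(n : ℝ)) ≤ m * (m - 1) := by nlinarith
    have h2 : (v ^ 2 - 3 * v) * n ≤ m * (m - 1) := by
      rw [mul_pow, hsq] at h1
      have : v * √(n : ℝ) ≤ v * n := by
        gcongr
        nlinarith
      linarith
    have h3 : (v ^ 2 - 3 * v) / 2 ≤ m * (m - 1) / (2 * n) := by
      rw [div_le_div_iff₀ two_pos (by positivity)]
      linarith
    nlinarith [sq_nonneg (v - 3)]
  calc (m : ℝ) / √(n : ℝ) * distinctProb n m
      ≤ v * Real.exp (9 / 4 + -(1 / 4) * v ^ 2) := by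
        gcongr
        · exact distinctProb_nonneg n m
        · rwa [div_le_iff₀ hs0]
        · exact hexp.trans (Real.exp_le_exp.mpr hquad)
    _ = _ := by rw [Real.exp_add]; ring

/-! ### Convergence of the bivariate distribution functions -/

/-- The conditional distribution function in the limit law of the first coordinate, given the value
`v` of the second one. -/
noncomputable def limitCondCDF (v a : ℝ) : ℝ := if 0 < a then dickman (v / a) else 0

theorem limitCondCDF_nonneg (v a : ℝ) : 0 ≤ limitCondCDF v a := by
  unfold limitCondCDF
  split_ifs
  exacts [dickman_nonneg _, le_rfl]

theorem measurable_dickman : Measurable dickman := by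
  classical
  have : dickman = (Set.Ici 0).piecewise dickman fun _ => 0 := by
    ext x
    by_cases hx : x ∈ Set.Ici (0 : ℝ)
    · rw [Set.piecewise_eq_of_mem _ _ _ hx]
    · rw [Set.piecewise_eq_of_notMem _ _ _ hx, dickman_of_neg (by simpa using hx)]
  rw [this]
  exact continuousOn_dickman.measurable_piecewise continuousOn_const measurableSet_Ici

/-- For `a > 0` and `n > 0` the probability is a sum over the number `m` of cyclic points, hence an
integral of a step function in `v` with `m = ⌊v * √n⌋`. Its integrand converges to the Rayleigh
density times `ρ (v / a)` below `b`, and to `0` above. -/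
theorem tendsto_uniformMapping_quadrant (a b : ℝ) :
    Tendsto (fun n => (uniformMapping n).real (scaledPair n ⁻¹' (Set.Iic a ×ˢ Set.Iic b))) atTop
      (nhds (∫ v in Set.Ici 0 ∩ Set.Iic b, v * Real.exp (-v ^ 2 / 2) * limitCondCDF v a)) := by
  classical
  -- For `a ≤ 0` the event is empty once `n > 0`, since every mapping then has a cycle.
  rcases le_or_gt a 0 with ha | ha
  · have : ∀ᶠ n : ℕ in atTop,
        (uniformMapping n).real (scaledPair n ⁻¹' (Set.Iic a ×ˢ Set.Iic b)) = 0 := by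
      filter_upwards [eventually_gt_atTop 0] with n hn
      have : scaledPair n ⁻¹' (Set.Iic a ×ˢ Set.Iic b) = ∅ := by
        refine Set.eq_empty_of_forall_notMem fun φ hφ => ?_
        have h1 : (longestCycle φ : ℝ) / √(n : ℝ) ≤ a := hφ.1
        have h2 : (0 : ℝ) < longestCycle φ := by exact_mod_cast longestCycle_pos hn.ne' φ
        have h3 : (0 : ℝ) < √(n : ℝ) := Real.sqrt_pos.mpr (by exact_mod_cast hn)
        have := div_pos h2 h3
        linarith
      rw [this, measureReal_empty]
    simp only [limitCondCDF, not_lt.mpr ha, if_false, mul_zero, integral_zero]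
    exact tendsto_const_nhds.congr' (this.mono fun n hn => hn.symm)
  let g : ℕ → ℕ → ℝ := fun n m => if (m : ℝ) / √(n : ℝ) ≤ b then
    cyclicProb n m * permCyclesLeProb m ⌊a * √(n : ℝ)⌋₊ else 0
  let F : ℕ → ℝ → ℝ := fun n v => √(n : ℝ) * g n ⌊v * √(n : ℝ)⌋₊
  have hF : ∀ᶠ n : ℕ in atTop, ∫ v in Set.Ici (0 : ℝ), F n v =
      (uniformMapping n).real (scaledPair n ⁻¹' (Set.Iic a ×ˢ Set.Iic b)) := by
    filter_upwards [eventually_gt_atTop 0] with n hn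
    have hs : (0 : ℝ) < √(n : ℝ) := Real.sqrt_pos.mpr (by exact_mod_cast hn)
    have hset : scaledPair n ⁻¹' (Set.Iic a ×ˢ Set.Iic b) =
        {φ | longestCycle φ ≤ ⌊a * √(n : ℝ)⌋₊ ∧ (numCyclicPoints φ : ℝ) / √(n : ℝ) ≤ b} := by
      ext φ
      simp only [scaledPair, Set.mem_preimage, Set.mem_prod, Set.mem_Iic, Set.mem_ofPred_eq]
      rw [Nat.le_floor_iff (by positivity), div_le_iff₀ hs]
    rw [hset, uniformMapping_longestCycle_le_and hn.ne' _
      (fun m => (m : ℝ) / √(n : ℝ) ≤ b)]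
    refine (integral_floor_mul (h := g n) (N := n + 1) hs fun m hm => ?_).trans
      (Finset.sum_congr rfl fun m _ => ?_)
    · simp only [g]
      rw [cyclicProb_of_lt hn.ne' hm, zero_mul, ite_self]
    · simp only [g]
  refine Tendsto.congr' hF ?_
  rw [← setIntegral_indicator measurableSet_Iic]
  refine tendsto_integral_filter_of_dominated_convergence
    (fun v => Real.exp (9 / 4) * (v * Real.exp (-(1 / 4) * v ^ 2))) ?_ ?_ ?_ ?_
  · refine Eventually.of_forall fun n => Measurable.aestronglyMeasurable ?_
    exact ((measurable_from_nat (f := g n)).comp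
      (Nat.measurable_floor.comp (measurable_id.mul_const _))).const_mul _
  · filter_upwards [eventually_gt_atTop 0] with n hn
    filter_upwards [ae_restrict_mem measurableSet_Ici] with v hv
    have hb := sqrt_mul_cyclicProb_le hn.ne' (show 0 ≤ v from hv)
    refine le_trans ?_ hb
    have h0 := cyclicProb_nonneg n ⌊v * √(n : ℝ)⌋₊
    simp only [F, g]
    split_ifs
    · have h1 := permCyclesLeProb_nonneg ⌊v * √(n : ℝ)⌋₊ ⌊a * √(n : ℝ)⌋₊
      have h2 := permCyclesLeProb_le_one ⌊v * √(n : ℝ)⌋₊ ⌊a * √(n : ℝ)⌋₊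
      rw [Real.norm_of_nonneg (by positivity)]
      exact mul_le_mul_of_nonneg_left (mul_le_of_le_one_right h0 h2) (Real.sqrt_nonneg _)
    · rw [mul_zero, norm_zero]
      positivity
  · exact ((integrable_mul_exp_neg_mul_sq (by norm_num)).const_mul _).integrableOn
  -- The cutoff at `b` jumps at `v = b`, where pointwise convergence may fail; this is a null set.
  · have hne : ∀ᵐ v ∂(volume.restrict (Set.Ici (0 : ℝ))), v ≠ b :=
      ae_restrict_of_ae (Measure.ae_ne volume b)
    filter_upwards [ae_restrict_mem measurableSet_Ici, hne] with v hv hvb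
    have hv : 0 ≤ v := hv
    have hfl := tendsto_floor_mul_sqrt_div hv
    rcases lt_or_gt_of_ne hvb with hlt | hgt
    · rw [Set.indicator_of_mem (show v ∈ Set.Iic b from hlt.le), limitCondCDF, if_pos ha]
      have hfa := tendsto_floor_mul_sqrt_div ha.le
      have hk : Tendsto (fun n : ℕ => ⌊a * √(n : ℝ)⌋₊) atTop atTop :=
        tendsto_nat_floor_atTop.comp (tendsto_sqrt_natCast_atTop.const_mul_atTop ha)
      have hmk : Tendsto (fun n : ℕ => (⌊v * √(n : ℝ)⌋₊ : ℝ) / ⌊a * √(n : ℝ)⌋₊) atTop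
          (nhds (v / a)) := by
        refine (hfl.div hfa ha.ne').congr' ?_
        filter_upwards [eventually_gt_atTop 0] with n hn
        have hs : (0 : ℝ) < √(n : ℝ) := Real.sqrt_pos.mpr (by exact_mod_cast hn)
        exact div_div_div_cancel_right₀ hs.ne' _ _
      refine ((tendsto_sqrt_mul_cyclicProb hv).mul (tendsto_permCyclesLeProb hk hmk)).congr' ?_
      filter_upwards [hfl.eventually_lt_const hlt] with n hn
      simp only [F, g, if_pos hn.le]
      ring
    · rw [Set.indicator_of_notMem (by simpa using hgt)]
      refine tendsto_const_nhds.congr' ?_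
      filter_upwards [hfl.eventually_const_lt hgt] with n hn
      simp only [F, g, if_neg (not_le.mpr hn), mul_zero]

/-! ### The distribution function and total mass of the limit law -/

theorem continuousOn_limitCondCDF {v : ℝ} (hv : 0 < v) :
    ContinuousOn (limitCondCDF v) (Set.Ici 0) := by
  intro a ha
  rcases (Set.mem_Ici.mp ha).eq_or_lt with rfl | ha
  · have h0 : limitCondCDF v 0 = 0 := by simp [limitCondCDF]
    rw [ContinuousWithinAt, h0]
    have hlim : Tendsto (fun a : ℝ => a / v) (nhdsWithin 0 (Set.Ici 0)) (nhds 0) := by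
      have : Tendsto (fun a : ℝ => a / v) (nhds 0) (nhds (0 / v)) :=
        (continuous_id.div_const v).tendsto 0
      rw [zero_div] at this
      exact this.mono_left nhdsWithin_le_nhds
    refine tendsto_of_tendsto_of_tendsto_of_le_of_le' tendsto_const_nhds hlim
      (Eventually.of_forall fun a => limitCondCDF_nonneg v a) ?_
    filter_upwards [self_mem_nhdsWithin, mem_nhdsWithin_of_mem_nhds (Iic_mem_nhds hv)] with a ha hav
    rcases (Set.mem_Ici.mp ha).eq_or_lt with rfl | ha
    · simp [limitCondCDF]
    · rw [limitCondCDF, if_pos ha]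
      refine (dickman_le_inv ?_).trans_eq (inv_div v a)
      rwa [one_le_div ha]
  · refine ContinuousAt.continuousWithinAt ?_
    have hd : ContinuousAt (fun a => dickman (v / a)) a :=
      ContinuousAt.comp_of_eq (y := v / a)
        (continuousOn_dickman.continuousAt (Ici_mem_nhds (by positivity)))
        (continuousAt_const.div continuousAt_id ha.ne') rfl
    refine hd.congr ?_
    filter_upwards [Ioi_mem_nhds ha] with y hy
    rw [limitCondCDF, if_pos (Set.mem_Ioi.mp hy)]

/-- The chain rule applied to `ρ (v / l)`: in `ρ' (v / l) = -ρ (v / l - 1) / (v / l)` the factor `v`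
cancels against the inner derivative `-v / l²`. -/
theorem hasDerivAt_limitCondCDF {v l : ℝ} (hl : 0 < l) (hlv : l < v) :
    HasDerivAt (limitCondCDF v) (dickman ((v - l) / l) / l) l := by
  have hv : 0 < v := hl.trans hlv
  have h1 : 1 < v / l := (one_lt_div hl).mpr hlv
  have h := (hasDerivAt_dickman h1).comp l ((hasDerivAt_inv hl.ne').const_mul v)
  have hsub : v / l - 1 = (v - l) / l := by field_simp
  rw [hsub] at h
  refine (h.congr_deriv ?_).congr_of_eventuallyEq ?_
  · field_simp
  · filter_upwards [Ioi_mem_nhds hl] with y hy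
    rw [limitCondCDF, if_pos (Set.mem_Ioi.mp hy)]
    rfl

theorem limitCondCDF_of_le {v a : ℝ} (hv : 0 < v) (h : v ≤ a) : limitCondCDF v a = 1 := by
  have ha : 0 < a := hv.trans_le h
  rw [limitCondCDF, if_pos ha, dickman_of_mem_Icc (by positivity) (by rwa [div_le_one ha])]

/-- The fundamental theorem of calculus on `[0, c]`. Continuity up to the endpoints suffices, and
integrability near `0` is automatic since the derivative is nonnegative. -/
theorem lintegral_Ioc_dickman_div {v c : ℝ} (hc : 0 < c) (hcv : c ≤ v) :
    ∫⁻ l in Set.Ioc 0 c, ENNReal.ofReal (dickman ((v - l) / l) / l) =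
      ENNReal.ofReal (limitCondCDF v c) := by
  have hv : 0 < v := hc.trans_le hcv
  have hcont : ContinuousOn (limitCondCDF v) (Set.Icc 0 c) :=
    (continuousOn_limitCondCDF hv).mono fun x hx => hx.1
  have hderiv : ∀ l ∈ Set.Ioo 0 c, HasDerivAt (limitCondCDF v) (dickman ((v - l) / l) / l) l :=
    fun l hl => hasDerivAt_limitCondCDF hl.1 (hl.2.trans_le hcv)
  have hint : IntegrableOn (fun l => dickman ((v - l) / l) / l) (Set.Ioc 0 c) :=
    intervalIntegral.integrableOn_deriv_of_nonneg hcont hderiv fun l hl =>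
      div_nonneg (dickman_nonneg _) hl.1.le
  rw [← ofReal_integral_eq_lintegral_ofReal hint, ← intervalIntegral.integral_of_le hc.le,
    intervalIntegral.integral_eq_sub_of_hasDerivAt_of_le hc.le hcont hderiv
      ((intervalIntegrable_iff_integrableOn_Ioc_of_le hc.le).mpr hint)]
  · simp [limitCondCDF]
  · filter_upwards [ae_restrict_mem measurableSet_Ioc] with l hl
    exact div_nonneg (dickman_nonneg _) hl.1.le

theorem jointDensity_of_nonpos {l v : ℝ} (hv : v ≤ 0) : jointDensity l v = 0 := by
  rw [jointDensity, if_neg]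
  rintro ⟨h1, h2⟩
  linarith

/-- For fixed `v > 0` the density is the Rayleigh density times the derivative of `limitCondCDF v`,
restricted to `(0, v)`; hence the cutoff at `min v a`. -/
theorem setLIntegral_jointDensity {v : ℝ} (hv : 0 ≤ v) (a : ℝ) :
    ∫⁻ l in Set.Iic a, ENNReal.ofReal (jointDensity l v) =
      ENNReal.ofReal (v * Real.exp (-v ^ 2 / 2) * limitCondCDF v a) := by
  rcases hv.eq_or_lt with rfl | hv
  · simp [jointDensity_of_nonpos]
  have hind : ∀ l, ENNReal.ofReal (jointDensity l v) = (Set.Ioo 0 v).indicator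
      (fun l => ENNReal.ofReal (v * Real.exp (-v ^ 2 / 2)) *
        ENNReal.ofReal (dickman ((v - l) / l) / l)) l := fun l => by
    by_cases hl : 0 < l ∧ l < v
    · rw [Set.indicator_of_mem (show l ∈ Set.Ioo 0 v from hl), jointDensity, if_pos hl,
        ← ENNReal.ofReal_mul (by positivity)]
      congr 1
      ring
    · rw [Set.indicator_of_notMem (show l ∉ Set.Ioo 0 v from hl), jointDensity, if_neg hl,
        ENNReal.ofReal_zero]
  have hae : (Set.Iic a ∩ Set.Ioo 0 v : Set ℝ) =ᵐ[volume] Set.Ioc 0 (min v a) := by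
    rw [Set.inter_comm, ← Set.Ioc_inter_Iic]
    exact Ioo_ae_eq_Ioc.inter (ae_eq_refl _)
  simp only [hind]
  rw [setLIntegral_indicator measurableSet_Ioo, Set.inter_comm, setLIntegral_congr hae,
    lintegral_const_mul' _ _ ENNReal.ofReal_ne_top]
  rcases le_or_gt a 0 with ha | ha
  · rw [Set.Ioc_eq_empty (by simp [ha])]
    simp [limitCondCDF, not_lt.mpr ha]
  · rw [lintegral_Ioc_dickman_div (lt_min hv ha) (min_le_left v a),
      ← ENNReal.ofReal_mul (by positivity)]
    rcases le_total a v with h | h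
    · rw [min_eq_right h]
    · rw [min_eq_left h, limitCondCDF_of_le hv le_rfl, limitCondCDF_of_le hv h]

theorem measurable_jointDensity : Measurable fun p : ℝ × ℝ => jointDensity p.1 p.2 := by
  unfold jointDensity
  have hd : Measurable fun p : ℝ × ℝ => dickman ((p.2 - p.1) / p.1) :=
    measurable_dickman.comp (by fun_prop)
  refine Measurable.ite ?_ (by fun_prop) measurable_const
  exact (measurableSet_lt measurable_const measurable_fst).inter
    (measurableSet_lt measurable_fst measurable_snd)

theorem measurable_limitCondCDF (a : ℝ) : Measurable fun v => limitCondCDF v a := by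
  unfold limitCondCDF
  split_ifs
  · exact measurable_dickman.comp (measurable_id.div_const a)
  · exact measurable_const

theorem limitLaw_prod (s t : Set ℝ) (hs : MeasurableSet s) (ht : MeasurableSet t) :
    limitLaw (s ×ˢ t) = ∫⁻ v in Set.Ici 0 ∩ t, ∫⁻ l in s, ENNReal.ofReal (jointDensity l v) := by
  rw [limitLaw, withDensity_apply _ (hs.prod ht), Measure.volume_eq_prod,
    setLIntegral_prod_symm _ measurable_jointDensity.ennreal_ofReal.aemeasurable,
    ← setLIntegral_indicator measurableSet_Ici]
  refine lintegral_congr fun v => ?_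
  by_cases hv : v ∈ Set.Ici (0 : ℝ)
  · rw [Set.indicator_of_mem hv]
  · rw [Set.indicator_of_notMem hv]
    simp [jointDensity_of_nonpos (not_le.mp hv).le]

theorem limitLaw_quadrant (a b : ℝ) :
    limitLaw.real (Set.Iic a ×ˢ Set.Iic b) =
      ∫ v in Set.Ici 0 ∩ Set.Iic b, v * Real.exp (-v ^ 2 / 2) * limitCondCDF v a := by
  have hm : MeasurableSet (Set.Ici (0 : ℝ) ∩ Set.Iic b) := measurableSet_Ici.inter measurableSet_Iic
  rw [measureReal_def, limitLaw_prod _ _ measurableSet_Iic measurableSet_Iic,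
    integral_eq_lintegral_of_nonneg_ae]
  · congr 1
    exact setLIntegral_congr_fun hm fun v hv => setLIntegral_jointDensity hv.1 a
  · filter_upwards [ae_restrict_mem hm] with v hv
    have h1 : 0 ≤ v := hv.1
    have h2 := limitCondCDF_nonneg v a
    change 0 ≤ v * Real.exp (-v ^ 2 / 2) * limitCondCDF v a
    positivity
  · have := measurable_limitCondCDF a
    exact Measurable.aestronglyMeasurable (by fun_prop)

theorem lintegral_rayleigh :
    ∫⁻ v in Set.Ioi (0 : ℝ), ENNReal.ofReal (v * Real.exp (-v ^ 2 / 2)) = 1 := by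
  have hderiv : ∀ v ∈ Set.Ici (0 : ℝ),
      HasDerivAt (fun v : ℝ => -Real.exp (-v ^ 2 / 2)) (v * Real.exp (-v ^ 2 / 2)) v := by
    intro v _
    have := ((((hasDerivAt_id v).pow 2).neg.div_const 2).exp).neg
    refine this.congr_deriv ?_
    simp only [id, Pi.pow_apply, Pi.neg_apply]
    ring
  have hlim : Tendsto (fun v : ℝ => -Real.exp (-v ^ 2 / 2)) atTop (nhds 0) := by
    have h : Tendsto (fun v : ℝ => -v ^ 2 / 2) atTop atBot := by
      have := (tendsto_pow_atTop (α := ℝ) two_ne_zero).atTop_div_const two_pos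
      refine (tendsto_neg_atTop_atBot.comp this).congr fun v => ?_
      simp [neg_div]
    simpa using (Real.tendsto_exp_atBot.comp h).neg
  have hint : IntegrableOn (fun v : ℝ => v * Real.exp (-v ^ 2 / 2)) (Set.Ioi 0) := by
    refine (integrable_mul_exp_neg_mul_sq (b := 1 / 2) (by norm_num)).integrableOn.congr_fun
      (fun v _ => ?_) measurableSet_Ioi
    simp only
    congr 2
    ring
  rw [← ofReal_integral_eq_lintegral_ofReal hint,
    integral_Ioi_of_hasDerivAt_of_tendsto' hderiv hint hlim]
  · simp
  · filter_upwards [ae_restrict_mem measurableSet_Ioi] with v hv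
    have : 0 < v := hv
    change 0 ≤ v * Real.exp (-v ^ 2 / 2)
    positivity

theorem isProbabilityMeasure_limitLaw : IsProbabilityMeasure limitLaw := by
  refine ⟨?_⟩
  rw [← Set.univ_prod_univ, limitLaw_prod _ _ MeasurableSet.univ MeasurableSet.univ,
    Set.inter_univ, setLIntegral_congr Ioi_ae_eq_Ici.symm, ← lintegral_rayleigh]
  refine setLIntegral_congr_fun measurableSet_Ioi fun v hv => ?_
  have hv : 0 < v := hv
  -- The whole mass in `l` lies below `v`, where the conditional distribution function has reached
  -- `1`; the Rayleigh integral remains.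
  have h := setLIntegral_jointDensity hv.le v
  rw [limitCondCDF_of_le hv le_rfl, mul_one] at h
  rw [← h, ← lintegral_indicator measurableSet_Iic, setLIntegral_univ]
  refine lintegral_congr fun l => ?_
  by_cases hl : l ∈ Set.Iic v
  · rw [Set.indicator_of_mem hl]
  · rw [Set.indicator_of_notMem hl, jointDensity, if_neg, ENNReal.ofReal_zero]
    exact fun h => hl h.2.le

/-! ### From distribution functions to weak convergence -/

/-- The half-open rectangles of the plane. -/
def halfOpenRectangles : Set (Set (ℝ × ℝ)) :=
  {s | ∃ a b c d : ℝ, a ≤ b ∧ c ≤ d ∧ s = Set.Ioc a b ×ˢ Set.Ioc c d}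

theorem isPiSystem_halfOpenRectangles : IsPiSystem halfOpenRectangles := by
  rintro _ ⟨a, b, c, d, -, -, rfl⟩ _ ⟨a', b', c', d', -, -, rfl⟩ hne
  rw [Set.prod_inter_prod, Set.Ioc_inter_Ioc, Set.Ioc_inter_Ioc] at hne ⊢
  obtain ⟨h1, h2⟩ := Set.prod_nonempty_iff.mp hne
  exact ⟨_, _, _, _, (Set.nonempty_Ioc.mp h1).le, (Set.nonempty_Ioc.mp h2).le, rfl⟩

/-- Together with the π-system property, this makes the half-open rectangles a
convergence-determining class. -/
theorem exists_halfOpenRectangle_subset {u : Set (ℝ × ℝ)} (hu : IsOpen u) {x : ℝ × ℝ}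
    (hx : x ∈ u) : ∃ s ∈ halfOpenRectangles, s ∈ nhds x ∧ s ⊆ u := by
  obtain ⟨ε, hε, hball⟩ := Metric.isOpen_iff.mp hu x hx
  refine ⟨_, ⟨x.1 - ε / 2, x.1 + ε / 2, x.2 - ε / 2, x.2 + ε / 2, by linarith, by linarith, rfl⟩,
    prod_mem_nhds (Ioc_mem_nhds (by linarith) (by linarith))
      (Ioc_mem_nhds (by linarith) (by linarith)), fun y hy => hball ?_⟩
  rw [Metric.mem_ball, Prod.dist_eq, max_lt_iff, Real.dist_eq, Real.dist_eq, abs_lt, abs_lt]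
  have h1 := hy.1.1
  have h2 := hy.1.2
  have h3 := hy.2.1
  have h4 := hy.2.2
  refine ⟨⟨?_, ?_⟩, ?_, ?_⟩ <;> linarith

theorem measureReal_halfOpenRectangle (μ : Measure (ℝ × ℝ)) [IsFiniteMeasure μ] {a b c d : ℝ}
    (hab : a ≤ b) (hcd : c ≤ d) :
    μ.real (Set.Ioc a b ×ˢ Set.Ioc c d) =
      μ.real (Set.Iic b ×ˢ Set.Iic d) - μ.real (Set.Iic a ×ˢ Set.Iic d) -
        (μ.real (Set.Iic b ×ˢ Set.Iic c) - μ.real (Set.Iic a ×ˢ Set.Iic c)) := by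
  have hstrip : ∀ t : Set ℝ, MeasurableSet t →
      μ.real (Set.Ioc a b ×ˢ t) = μ.real (Set.Iic b ×ˢ t) - μ.real (Set.Iic a ×ˢ t) := by
    intro t ht
    rw [← measureReal_sdiff (Set.prod_mono (Set.Iic_subset_Iic.mpr hab) subset_rfl)
      (measurableSet_Iic.prod ht)]
    congr 1
    ext p
    simp only [Set.mem_prod, Set.mem_Ioc, Set.mem_sdiff, Set.mem_Iic, not_and]
    constructor
    · rintro ⟨⟨h1, h2⟩, h3⟩
      exact ⟨⟨h2, h3⟩, fun h => absurd h (not_le.mpr h1)⟩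
    · rintro ⟨⟨h2, h3⟩, h⟩
      exact ⟨⟨not_le.mp fun h' => h h' h3, h2⟩, h3⟩
  have hdiff : Set.Ioc a b ×ˢ Set.Ioc c d =
      (Set.Ioc a b ×ˢ Set.Iic d) \ (Set.Ioc a b ×ˢ Set.Iic c) := by
    ext p
    simp only [Set.mem_prod, Set.mem_Ioc, Set.mem_sdiff, Set.mem_Iic, not_and, not_le]
    tauto
  rw [hdiff, measureReal_sdiff (Set.prod_mono subset_rfl (Set.Iic_subset_Iic.mpr hcd))
    (measurableSet_Ioc.prod measurableSet_Iic), hstrip _ measurableSet_Iic,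
    hstrip _ measurableSet_Iic]

/-- Convergence of the bivariate distribution functions at all points implies weak convergence. -/
theorem tendsto_probabilityMeasure_of_tendsto_quadrant {μ : ℕ → ProbabilityMeasure (ℝ × ℝ)}
    {ν : ProbabilityMeasure (ℝ × ℝ)}
    (h : ∀ a b : ℝ, Tendsto (fun n => (μ n : Measure (ℝ × ℝ)).real (Set.Iic a ×ˢ Set.Iic b)) atTop
      (nhds ((ν : Measure (ℝ × ℝ)).real (Set.Iic a ×ˢ Set.Iic b)))) :
    Tendsto μ atTop (nhds ν) := by
  refine isPiSystem_halfOpenRectangles.tendsto_probabilityMeasure_of_tendsto_of_mem ?_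
    (fun u hu x hx => exists_halfOpenRectangle_subset hu hx) ?_
  · rintro _ ⟨a, b, c, d, -, -, rfl⟩
    exact measurableSet_Ioc.prod measurableSet_Ioc
  · rintro _ ⟨a, b, c, d, hab, hcd, rfl⟩
    have : Tendsto (fun n => (μ n : Measure (ℝ × ℝ)).real (Set.Ioc a b ×ˢ Set.Ioc c d)) atTop
        (nhds ((ν : Measure (ℝ × ℝ)).real (Set.Ioc a b ×ˢ Set.Ioc c d))) := by
      simp only [measureReal_halfOpenRectangle _ hab hcd]
      exact ((h b d).sub (h a d)).sub ((h b c).sub (h a c))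
    simpa using this

theorem mainTheorem1 :
    (∀ l v : ℝ, 0 ≤ jointDensity l v) ∧
    ∃ _ : IsProbabilityMeasure limitLaw,
      TendstoInDistribution scaledPair atTop (id : ℝ × ℝ → ℝ × ℝ) uniformMapping limitLaw := by
  refine ⟨jointDensity_nonneg, isProbabilityMeasure_limitLaw, ?_⟩
  have := isProbabilityMeasure_limitLaw
  have hmeas : ∀ n, Measurable (scaledPair n) := fun n => measurable_of_finite _
  refine ⟨fun n => (hmeas n).aemeasurable, aemeasurable_id, ?_⟩
  refine tendsto_probabilityMeasure_of_tendsto_quadrant fun a b => ?_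
  simp only [ProbabilityMeasure.coe_mk, Measure.map_id]
  rw [limitLaw_quadrant]
  refine (tendsto_uniformMapping_quadrant a b).congr fun n => ?_
  rw [map_measureReal_apply (hmeas n) (measurableSet_Iic.prod measurableSet_Iic)]
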